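/- Let $\mathcal{A}$ be a compact set of real $2\times 2$ matrices that is irreducible, i.e., the matrices of $\mathcal{A}$ have no common invariant subspace except $\{0\}$ and $\mathbb{R}^2$. A trajectory of $\mathcal{A}$ is a solution on $[0,\infty)$ of $\dot x(t)=A(t)x(t)$ for some measurable $A:[0,\infty)\to\mathcal{A}$. The Lyapunov exponent $\sigma(\mathcal{A})$ is the infimum of the numbers $s$ such that every trajectory satisfies $\|x(t)\|\le Ce^{st}$, $t\ge 0$, with a constant $C=C(x)$. A matrix $A\in\mathrm{co}(\mathcal{A})$, $A\neq\sigma(\mathcal{A})I$, is dominant if the largest real part of its eigenvalues is $\sigma(\mathcal{A})$; $\mathcal{A}$ has complex dominance if $\mathrm{co}(\mathcal{A})$ contains a dominant matrix with non-real eigenvalues. A norm $f$ on $\mathbb{R}^2$ is a Barabanov norm of $\mathcal{A}$ if $f(x(t))\le e^{\sigma(\mathcal{A})t}f(x(0))$ for every trajectory $x$ of $\mathcal{A}$ and all $t\ge 0$, and for every $x_0\in\mathbb{R}^2$ there is a trajectory $\bar x$ of $\mathrm{co}(\mathcal{A})$ with $\bar x(0)=x_0$ and $f(\bar x(t))=e^{\sigma(\mathcal{A})t}f(x_0)$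 for all $t\ge 0$. Then $\mathcal{A}$ has complex dominance if and only if there exists a matrix $A_0\in\mathcal{A}$ with eigenvalues $\alpha\pm\beta i$, $\alpha,\beta\in\mathbb{R}$, $\beta\ne 0$, such that the system of linear matrix inequalities $$A^TM+MA\preceq 2\alpha M,\qquad A\in\mathcal{A},$$ has a symmetric solution $M\succ 0$. Moreover, for any such $A_0,\alpha,\beta,M$: $\sigma(\mathcal{A})=\alpha$, the matrix $A_0$ is dominant, and $f(x)=\sqrt{x^TMx}$ is a Barabanov norm of $\mathcal{A}$, which is unique up to multiplication by a positive constant. -/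

import Mathlib

open Matrix

/-- `x` is a trajectory, on `[0, ∞)`, of the linear switching system with control set `𝒜`:
there is a measurable switching law `A` with values in `𝒜` such that `x` is the (Carathéodory)
solution of `x'(t) = A(t) x(t)`, i.e. `x` is continuous and satisfies the integral equation. -/
def IsTrajectory {d : ℕ} (𝒜 : Set (Matrix (Fin d) (Fin d) ℝ)) (x : ℝ → Fin d → ℝ) : Prop :=
  ∃ A : ℝ → Matrix (Fin d) (Fin d) ℝ,
    (∀ i j, Measurable fun t => A t i j) ∧
    (∀ t, 0 ≤ t → A t ∈ 𝒜) ∧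
    ContinuousOn x (Set.Ici 0) ∧
    ∀ t, 0 ≤ t →
      IntervalIntegrable (fun s => A s *ᵥ x s) MeasureTheory.volume 0 t ∧
      x t = x 0 + ∫ s in (0 : ℝ)..t, A s *ᵥ x s

/-- The Lyapunov exponent `σ(𝒜)`: the infimum of the numbers `s` such that every trajectory is
bounded by `C e^{s t}`, where `C` may depend on the trajectory (so that the choice of the norm
on `ℝ^d` is immaterial). -/
noncomputable def lyapunovExponent {d : ℕ} (𝒜 : Set (Matrix (Fin d) (Fin d) ℝ)) : ℝ :=
  sInf {s : ℝ | ∀ x : ℝ → Fin d → ℝ, IsTrajectory 𝒜 x →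
    ∃ C : ℝ, ∀ t, 0 ≤ t → ‖x t‖ ≤ C * Real.exp (s * t)}

/-- The only common invariant subspaces of the matrices of `𝒜` are `0` and `ℝ^d`. -/
def IsIrreducibleFamily {d : ℕ} (𝒜 : Set (Matrix (Fin d) (Fin d) ℝ)) : Prop :=
  ∀ L : Submodule ℝ (Fin d → ℝ), (∀ A ∈ 𝒜, ∀ v ∈ L, A *ᵥ v ∈ L) → L = ⊥ ∨ L = ⊤

/-- The set of complex eigenvalues of a real matrix. -/
def complexSpectrum {d : ℕ} (A : Matrix (Fin d) (Fin d) ℝ) : Set ℂ :=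
  spectrum ℂ (A.map ((↑) : ℝ → ℂ))

/-- `A` is a dominant matrix of the system `𝒜`: it belongs to the convex hull of `𝒜`, differs from
`σ I`, and the largest real part of its eigenvalues is `σ = σ(𝒜)`. -/
def IsDominant {d : ℕ} (𝒜 : Set (Matrix (Fin d) (Fin d) ℝ)) (A : Matrix (Fin d) (Fin d) ℝ) :
    Prop :=
  A ∈ convexHull ℝ 𝒜 ∧
  A ≠ lyapunovExponent 𝒜 • (1 : Matrix (Fin d) (Fin d) ℝ) ∧
  IsGreatest (Complex.re '' complexSpectrum A) (lyapunovExponent 𝒜)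

/-- A planar system has complex dominance if it has a dominant matrix with non-real eigenvalues. -/
def HasComplexDominance (𝒜 : Set (Matrix (Fin 2) (Fin 2) ℝ)) : Prop :=
  ∃ A, IsDominant 𝒜 A ∧ ∀ z ∈ complexSpectrum A, z.im ≠ 0

/-- `f` is a norm on `ℝ^d`. -/
structure IsNormOn {d : ℕ} (f : (Fin d → ℝ) → ℝ) : Prop where
  add_le : ∀ x y, f (x + y) ≤ f x + f y
  smul_eq : ∀ (c : ℝ) (x), f (c • x) = |c| * f x
  eq_zero : ∀ x, f x = 0 → x = 0

/-- `f` is a Barabanov (invariant) norm of the system `𝒜`: a norm which grows at most as `e^{σ t}`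
along every trajectory of `𝒜`, and exactly as `e^{σ t}` along some trajectory of the
system `co(𝒜)` starting at any given point. -/
structure IsBarabanovNorm {d : ℕ} (𝒜 : Set (Matrix (Fin d) (Fin d) ℝ))
    (f : (Fin d → ℝ) → ℝ) : Prop where
  isNorm : IsNormOn f
  le_exp : ∀ x, IsTrajectory 𝒜 x →
    ∀ t, 0 ≤ t → f (x t) ≤ Real.exp (lyapunovExponent 𝒜 * t) * f (x 0)
  exists_extremal : ∀ x₀, ∃ x, IsTrajectory (convexHull ℝ 𝒜) x ∧ x 0 = x₀ ∧
    ∀ t, 0 ≤ t → f (x t) = Real.exp (lyapunovExponent 𝒜 * t) * f x₀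

/-- `x ↦ √(xᵀ M x)`. -/
noncomputable def quadraticNorm {d : ℕ} (M : Matrix (Fin d) (Fin d) ℝ) (x : Fin d → ℝ) : ℝ :=
  Real.sqrt (x ⬝ᵥ M *ᵥ x)

/-- `M ≻ 0` solves the system of linear matrix inequalities `Aᵀ M + M A ⪯ 2 α M`, `A ∈ 𝒜`. -/
def SolvesLMI {d : ℕ} (𝒜 : Set (Matrix (Fin d) (Fin d) ℝ)) (α : ℝ)
    (M : Matrix (Fin d) (Fin d) ℝ) : Prop :=
  M.PosDef ∧ ∀ A ∈ 𝒜, ((2 * α) • M - (Aᵀ * M + M * A)).PosSemidef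

/-! A planar matrix with eigenvalues `α ± bi`, `b > 0`, is `α + b J` with `J² = -1`: up to the
factor `exp (α t)`, its flow is the rotation `exp (b t J)`, which runs along the ellipses of a
`J`-invariant quadratic form. Both directions compare the other matrices with these ellipses.

Suppose the hull contains `σ + b J`, and let `M` be `J`-invariant. If some `B ∈ 𝒜` pushed a point
`v` strictly outside its ellipse, a further rotation would carry it to `l v` with `l > 1`. The
normalized propagator of these two arcs would then have the eigenvalue `l`, so periodic repetition
would beat the exponent `σ`. To make this rigorous, the propagators of piecewise constant laws are
treated as a monoid. For every rate above `σ` its elements have bounded powers, which yields a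
determinant inequality that survives closure; the closure contains the propagators of the hull by
the Lie product formula. Hence `M` solves the inequalities (`solvesLMI_of_rotation`). They are
equalities at the dominant matrix, so convexity produces a matrix of `𝒜` other than `σ I` where they
are also equalities (`SolvesLMI.exists_skew_mem`); in the plane such a matrix has non-real
eigenvalues with real part `σ`.

Conversely, a solution `M` bounds all growth by `exp (α t)`. For `A₀ = α + b J` the inequality at
`v` and at `J v` forces `J` to preserve the form, so `A₀` attains this rate from every starting
point. Uniqueness holds because the rotations act transitively on each ellipse and no Barabanov norm
can increase along them. -/

/-! ### Growth of quadratic forms along Carathéodory trajectories -/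

open MeasureTheory in
theorem AbsolutelyContinuousOnInterval.le_of_ae_hasDerivAt_nonpos {f f' : ℝ → ℝ} {a b : ℝ}
    (hab : a ≤ b) (hf : AbsolutelyContinuousOnInterval f a b)
    (hd : ∀ᵐ t, t ∈ Set.uIcc a b → HasDerivAt f (f' t) t ∧ f' t ≤ 0) : f b ≤ f a := by
  have h := hf.integral_deriv_eq_sub
  have h0 : 0 ≤ ∫ t in a..b, -deriv f t := by
    refine intervalIntegral.integral_nonneg_of_ae_restrict hab ?_
    rw [Filter.EventuallyLE, ae_restrict_iff' measurableSet_Icc]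
    filter_upwards [hd] with t ht hmem
    have := ht (by rwa [Set.uIcc_of_le hab])
    simpa [this.1.deriv] using this.2
  rw [intervalIntegral.integral_neg] at h0
  linarith

theorem AbsolutelyContinuousOnInterval.fun_sum {ι : Type*} {a b : ℝ} (s : Finset ι)
    {f : ι → ℝ → ℝ} (hf : ∀ i ∈ s, AbsolutelyContinuousOnInterval (f i) a b) :
    AbsolutelyContinuousOnInterval (fun t => ∑ i ∈ s, f i t) a b := by
  classical
  induction s using Finset.induction_on with
  | empty =>
    simpa using (contDiffOn_const (c := (0 : ℝ))).absolutelyContinuousOnInterval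
  | insert i s hi ih =>
    simp only [Finset.sum_insert hi]
    exact (hf i (by simp)).fun_add (ih fun j hj => hf j (by simp [hj]))

theorem Matrix.IsHermitian.dotProduct_mulVec_comm {n : Type*} [Fintype n] {M : Matrix n n ℝ}
    (hM : M.IsHermitian) (x y : n → ℝ) : x ⬝ᵥ M *ᵥ y = y ⬝ᵥ M *ᵥ x := by
  have hT : Mᵀ = M := by rw [← conjTranspose_eq_transpose_of_trivial]; exact hM
  rw [← dotProduct_transpose_mulVec, hT]

/-- The derivative of `xᵀ M x` along `x' = A x` is `2 xᵀ M A x`, so this identity translates between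
the matrix inequality and a pointwise growth bound. -/
theorem dotProduct_sub_lyapunov {n : Type*} [Fintype n] (A M : Matrix n n ℝ)
    (hM : M.IsHermitian) (c : ℝ) (x : n → ℝ) :
    x ⬝ᵥ (c • M - (Aᵀ * M + M * A)) *ᵥ x = c * (x ⬝ᵥ M *ᵥ x) - 2 * (x ⬝ᵥ M *ᵥ (A *ᵥ x)) := by
  have h : x ⬝ᵥ (Aᵀ * M) *ᵥ x = x ⬝ᵥ M *ᵥ (A *ᵥ x) := by
    rw [← mulVec_mulVec, dotProduct_mulVec, vecMul_transpose, hM.dotProduct_mulVec_comm]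
  rw [sub_mulVec, add_mulVec, dotProduct_sub, dotProduct_add, h, smul_mulVec, dotProduct_smul,
    ← mulVec_mulVec, smul_eq_mul]
  ring

theorem HasDerivAt.quadraticForm {n : Type*} [Fintype n] {u : ℝ → n → ℝ} {w : n → ℝ} {s : ℝ}
    (hu : HasDerivAt u w s) {M : Matrix n n ℝ} (hM : M.IsHermitian) :
    HasDerivAt (fun t => u t ⬝ᵥ M *ᵥ u t) (2 * (u s ⬝ᵥ M *ᵥ w)) s := by
  have hi := hasDerivAt_pi.1 hu
  have h := HasDerivAt.fun_sum (u := Finset.univ) fun i _ =>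
    (hi i).fun_mul (HasDerivAt.fun_sum (u := Finset.univ) fun j _ => (hi j).const_mul (M i j))
  refine h.congr_deriv ?_
  rw [Finset.sum_add_distrib]
  change w ⬝ᵥ M *ᵥ u s + u s ⬝ᵥ M *ᵥ w = _
  rw [hM.dotProduct_mulVec_comm w]
  ring

/-- A quadratic form solving the Lyapunov inequality grows at most exponentially along
trajectories. -/
theorem IsTrajectory.quadratic_le {d : ℕ} {𝒜 : Set (Matrix (Fin d) (Fin d) ℝ)}
    {x : ℝ → Fin d → ℝ} (hx : IsTrajectory 𝒜 x) {M : Matrix (Fin d) (Fin d) ℝ} {α : ℝ}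
    (hM : M.IsHermitian)
    (hle : ∀ A ∈ 𝒜, ∀ v : Fin d → ℝ, v ⬝ᵥ M *ᵥ (A *ᵥ v) ≤ α * (v ⬝ᵥ M *ᵥ v))
    {t : ℝ} (ht : 0 ≤ t) :
    x t ⬝ᵥ M *ᵥ x t ≤ Real.exp (2 * α * t) * (x 0 ⬝ᵥ M *ᵥ x 0) := by
  obtain ⟨A, -, hA, -, hint⟩ := hx
  have hi := (hint t ht).1
  set w : ℝ → Fin d → ℝ := fun s => A s *ᵥ x s with hw
  have hwi : ∀ i, IntervalIntegrable (fun s => w s i) MeasureTheory.volume 0 t := fun i => by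
    rw [intervalIntegrable_iff] at hi ⊢
    exact hi.eval i
  -- The hypothesis describes `x` only for nonnegative times. The integral formula extends it to all
  -- of `ℝ`, giving two-sided derivatives almost everywhere and absolute continuity.
  set u : Fin d → ℝ → ℝ := fun i s => x 0 i + ∫ r in (0 : ℝ)..s, w r i with hu
  set u' : ℝ → Fin d → ℝ := fun s i => u i s with hu'
  have hux : ∀ s ∈ Set.uIcc 0 t, u' s = x s := by
    intro s hs
    funext i
    rw [Set.uIcc_of_le ht] at hs
    rw [(hint s hs.1).2, Pi.add_apply]
    refine congrArg (x 0 i + ·) ?_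
    have hs' := (hint s hs.1).1
    rw [intervalIntegral.integral_of_le hs.1, intervalIntegral.integral_of_le hs.1,
      MeasureTheory.eval_integral]
    intro j
    rw [intervalIntegrable_iff_integrableOn_Ioc_of_le hs.1] at hs'
    exact hs'.eval j
  have huAC : ∀ i, AbsolutelyContinuousOnInterval (u i) 0 t := fun i =>
    (contDiffOn_const (c := x 0 i)).absolutelyContinuousOnInterval.fun_add
      ((hwi i).absolutelyContinuousOnInterval_intervalIntegral (c := 0) (by simp))
  have hud : ∀ᵐ s, s ∈ Set.uIcc 0 t → HasDerivAt u' (w s) s := by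
    have : ∀ i, ∀ᵐ s, s ∈ Set.uIcc 0 t → HasDerivAt (u i) (w s i) s := fun i => by
      filter_upwards [(hwi i).ae_hasDerivAt_integral] with s hs hmem
      exact (hs hmem 0 (by simp)).const_add (x 0 i)
    filter_upwards [MeasureTheory.ae_all_iff.2 this] with s hs hmem
    exact hasDerivAt_pi.2 fun i => hs i hmem
  have hq : ∀ s, u' s ⬝ᵥ M *ᵥ u' s = ∑ i, u i s * ∑ j, M i j * u j s := fun s => rfl
  set V : ℝ → ℝ := fun s => Real.exp (-(2 * α * s)) * (u' s ⬝ᵥ M *ᵥ u' s) with hV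
  have hVAC : AbsolutelyContinuousOnInterval V 0 t := by
    refine AbsolutelyContinuousOnInterval.fun_mul ?_ ?_
    · exact (ContDiff.contDiffOn (by fun_prop)).absolutelyContinuousOnInterval
    · simp only [hq]
      exact .fun_sum _ fun i _ => (huAC i).fun_mul (.fun_sum _ fun j _ => (huAC j).const_mul _)
  have hVx : ∀ s ∈ Set.uIcc 0 t, V s = Real.exp (-(2 * α * s)) * (x s ⬝ᵥ M *ᵥ x s) := by
    intro s hs
    rw [hV, ← hux s hs]
  have key : V t ≤ V 0 := by
    refine hVAC.le_of_ae_hasDerivAt_nonpos ht (f' := fun s => Real.exp (-(2 * α * s)) *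
      (2 * (u' s ⬝ᵥ M *ᵥ (w s)) - 2 * α * (u' s ⬝ᵥ M *ᵥ u' s))) ?_
    filter_upwards [hud] with s hs hmem
    specialize hs hmem
    constructor
    · have h1 : HasDerivAt (fun s : ℝ => Real.exp (-(2 * α * s)))
          (Real.exp (-(2 * α * s)) * (-(2 * α * 1))) s :=
        (((hasDerivAt_id s).const_mul (2 * α)).neg).exp
      refine (h1.mul (hs.quadraticForm hM)).congr_deriv ?_
      ring
    · rw [Set.uIcc_of_le ht] at hmem
      have := hle (A s) (hA s hmem.1) (x s)
      refine mul_nonpos_of_nonneg_of_nonpos (Real.exp_pos _).le ?_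
      rw [hux s (by rwa [Set.uIcc_of_le ht]), hw]
      linarith
  rw [hVx t (by simp), hVx 0 (by simp)] at key
  simp only [mul_zero, neg_zero, Real.exp_zero, one_mul] at key
  calc x t ⬝ᵥ M *ᵥ x t
      = Real.exp (2 * α * t) * (Real.exp (-(2 * α * t)) * (x t ⬝ᵥ M *ᵥ x t)) := by
        rw [← mul_assoc, ← Real.exp_add]; simp
    _ ≤ _ := by gcongr

theorem IsTrajectory.mono {d : ℕ} {𝒜 ℬ : Set (Matrix (Fin d) (Fin d) ℝ)} (h : 𝒜 ⊆ ℬ)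
    {x : ℝ → Fin d → ℝ} (hx : IsTrajectory 𝒜 x) : IsTrajectory ℬ x := by
  obtain ⟨A, h1, h2, h3⟩ := hx
  exact ⟨A, h1, fun t ht => h (h2 t ht), h3⟩

/-! ### Trajectories with piecewise constant switching -/

open MeasureTheory in
/-- A continuous curve with right derivative `A t *ᵥ x t` for a bounded measurable switching law
`A` is a trajectory. -/
theorem isTrajectory_of_hasDerivWithinAt {d : ℕ} {𝒜 : Set (Matrix (Fin d) (Fin d) ℝ)}
    {A : ℝ → Matrix (Fin d) (Fin d) ℝ} {x : ℝ → Fin d → ℝ} {K : ℝ}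
    (hmeas : ∀ i j, Measurable fun t => A t i j) (hA : ∀ t, 0 ≤ t → A t ∈ 𝒜)
    (hK : ∀ t, 0 ≤ t → ∀ i j, |A t i j| ≤ K) (hx : ContinuousOn x (Set.Ici 0))
    (hd : ∀ t, 0 ≤ t → HasDerivWithinAt x (A t *ᵥ x t) (Set.Ioi t) t) :
    IsTrajectory 𝒜 x := by
  refine ⟨A, hmeas, hA, hx, fun t ht => ?_⟩
  have hxt : ContinuousOn x (Set.Icc 0 t) := hx.mono Set.Icc_subset_Ici_self
  have hint : IntervalIntegrable (fun s => A s *ᵥ x s) volume 0 t := by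
    rw [intervalIntegrable_iff_integrableOn_Icc_of_le ht]
    refine Integrable.of_eval fun i => ?_
    simp only [mulVec, dotProduct]
    refine integrable_finsetSum _ fun j _ => ?_
    have hxj : ContinuousOn (fun s => x s j) (Set.Icc 0 t) :=
      (continuous_apply j).comp_continuousOn hxt
    refine Integrable.bdd_mul (c := K) (hxj.integrableOn_compact isCompact_Icc)
      (hmeas i j).aestronglyMeasurable ?_
    rw [ae_restrict_iff' measurableSet_Icc]
    exact Filter.Eventually.of_forall fun s hs => hK s hs.1 i j
  refine ⟨hint, ?_⟩
  rw [intervalIntegral.integral_eq_sub_of_hasDeriv_right (by rwa [Set.uIcc_of_le ht]) _ hint]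
  · simp
  · intro s hs
    rw [min_eq_left ht] at hs
    exact hd s hs.1.le

section
open scoped Matrix.Norms.Operator

theorem Matrix.hasDerivAt_exp_mulVec {n : Type*} [Fintype n] [DecidableEq n] (A : Matrix n n ℝ)
    (y : n → ℝ) (a t : ℝ) :
    HasDerivAt (fun s : ℝ => NormedSpace.exp ((s - a) • A) *ᵥ y)
      (A *ᵥ (NormedSpace.exp ((t - a) • A) *ᵥ y)) t := by
  have h : HasDerivAt (fun s : ℝ => NormedSpace.exp ((s - a) • A))
      (A * NormedSpace.exp ((t - a) • A)) t := by
    have h := (hasDerivAt_exp_smul_const' (𝕂 := ℝ) A (t - a)).scomp t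
      ((hasDerivAt_id t).sub_const a)
    rw [one_smul] at h
    exact h
  rw [mulVec_mulVec]
  exact ((LinearMap.toContinuousLinearMap
    ((Matrix.mulVecBilin ℝ ℝ).flip y)).hasFDerivAt.comp_hasDerivAt t h)

end

theorem IsCompact.exists_entry_bound {m n : Type*} [Finite m] [Finite n] {𝒜 : Set (Matrix m n ℝ)}
    (h : IsCompact 𝒜) : ∃ K : ℝ, ∀ A ∈ 𝒜, ∀ i j, |A i j| ≤ K := by
  cases nonempty_fintype m
  cases nonempty_fintype n
  have : ∀ p : m × n, ∃ K : ℝ, ∀ A ∈ 𝒜, |A p.1 p.2| ≤ K := fun p => by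
    obtain ⟨K, hK⟩ := h.exists_bound_of_continuousOn (f := fun A : Matrix m n ℝ => A p.1 p.2)
      (by fun_prop)
    exact ⟨K, fun A hA => by simpa using hK A hA⟩
  choose K hK using this
  refine ⟨∑ p, |K p|, fun A hA i j => (hK (i, j) A hA).trans ((le_abs_self _).trans ?_)⟩
  exact Finset.single_le_sum (f := fun p => |K p|) (fun p _ => abs_nonneg _) (Finset.mem_univ _)

theorem isTrajectory_exp {d : ℕ} {𝒜 : Set (Matrix (Fin d) (Fin d) ℝ)}
    {A : Matrix (Fin d) (Fin d) ℝ} (hA : A ∈ 𝒜) (y : Fin d → ℝ) :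
    IsTrajectory 𝒜 fun t => NormedSpace.exp (t • A) *ᵥ y := by
  have hd : ∀ t : ℝ, HasDerivAt (fun t : ℝ => NormedSpace.exp (t • A) *ᵥ y)
      (A *ᵥ (NormedSpace.exp (t • A) *ᵥ y)) t := fun t => by
    simpa using A.hasDerivAt_exp_mulVec y 0 t
  refine isTrajectory_of_hasDerivWithinAt (A := fun _ => A) (K := ∑ p : Fin d × Fin d, |A p.1 p.2|)
    (fun i j => measurable_const) (fun _ _ => hA)
    (fun t _ i j => Finset.single_le_sum (f := fun p : Fin d × Fin d => |A p.1 p.2|)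
      (fun p _ => abs_nonneg _) (Finset.mem_univ (i, j)))
    (fun t _ => (hd t).continuousAt.continuousWithinAt) fun t _ => (hd t).hasDerivWithinAt

/-- Concatenation of countably many arcs with constant switching law. -/
theorem exists_isTrajectory_of_seq {d : ℕ} {𝒜 : Set (Matrix (Fin d) (Fin d) ℝ)}
    (hc : IsCompact 𝒜) {S : ℕ → ℝ} (hS0 : S 0 = 0) (hS : StrictMono S)
    (hSt : Filter.Tendsto S Filter.atTop Filter.atTop) {B : ℕ → Matrix (Fin d) (Fin d) ℝ}
    (hB : ∀ k, B k ∈ 𝒜) {y : ℕ → Fin d → ℝ}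
    (hy : ∀ k, y (k + 1) = NormedSpace.exp ((S (k + 1) - S k) • B k) *ᵥ y k) :
    ∃ x, IsTrajectory 𝒜 x ∧ ∀ k, x (S k) = y k := by
  classical
  obtain ⟨K, hK⟩ := hc.exists_entry_bound
  have hex : ∀ t : ℝ, ∃ k, t < S (k + 1) := fun t =>
    (((Filter.tendsto_add_atTop_iff_nat 1).2 hSt).eventually_gt_atTop t).exists
  -- The index of the arc active at time `t`. Only the right endpoint is tested, so negative times
  -- get index 0 and `κ` is monotone on all of `ℝ`, which makes the switching law measurable.
  set κ : ℝ → ℕ := fun t => Nat.find (hex t) with hκ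
  have hκ_eq : ∀ k t, S k ≤ t → t < S (k + 1) → κ t = k := by
    intro k t h1 h2
    rw [hκ]
    dsimp only
    rw [Nat.find_eq_iff]
    refine ⟨h2, fun n hn => not_lt.2 ?_⟩
    exact (hS.monotone hn).trans h1
  have hκ_lt : ∀ t, t < S (κ t + 1) := fun t => Nat.find_spec (hex t)
  have hκ_le : ∀ t, 0 ≤ t → S (κ t) ≤ t := by
    intro t ht
    rcases h : κ t with _ | k
    · rwa [hS0]
    · have := Nat.find_min (hex t) (m := k) (by change k < κ t; omega)
      exact not_lt.1 this
  have hκ_mono : Monotone κ := by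
    intro s t hst
    exact Nat.find_min' _ (hst.trans_lt (hκ_lt t))
  set g : ℕ → ℝ → Fin d → ℝ := fun k t => NormedSpace.exp ((t - S k) • B k) *ᵥ y k with hg
  have hgd : ∀ k t, HasDerivAt (g k) (B k *ᵥ g k t) t := fun k t =>
    (B k).hasDerivAt_exp_mulVec (y k) (S k) t
  have hgk : ∀ k, g k (S k) = y k := fun k => by simp [hg]
  set x : ℝ → Fin d → ℝ := fun t => g (κ t) t with hx
  have hxg : ∀ k, Set.EqOn x (g k) (Set.Icc (S k) (S (k + 1))) := by
    intro k t ht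
    rcases ht.2.lt_or_eq with h | h
    · change g (κ t) t = g k t
      rw [hκ_eq k t ht.1 h]
    · subst h
      change g (κ (S (k + 1))) _ = _
      rw [hκ_eq (k + 1) _ le_rfl (hS (Nat.lt_succ_self _)), hgk, hy]
  have hright : ∀ t, 0 ≤ t → HasDerivWithinAt x (B (κ t) *ᵥ x t) (Set.Ici t) t := by
    intro t ht
    refine ((hgd (κ t) t).hasDerivWithinAt).congr_of_eventuallyEq ?_ rfl
    filter_upwards [Icc_mem_nhdsGE (hκ_lt t)] with s hs
    exact hxg _ ⟨(hκ_le t ht).trans hs.1, hs.2⟩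
  -- At a switching time `κ` already points to the new arc, so continuity from the left has to be
  -- read off the arc that ends there.
  have hleft : ∀ t, 0 < t → ContinuousWithinAt x (Set.Iic t) t := by
    intro t ht
    obtain ⟨k, hk1, hk2⟩ : ∃ k, S k < t ∧ t ≤ S (k + 1) := by
      rcases (hκ_le t ht.le).lt_or_eq with h | h
      · exact ⟨_, h, (hκ_lt t).le⟩
      · rcases hk : κ t with _ | k
        · rw [hk, hS0] at h
          exact absurd h ht.ne
        · rw [hk] at h
          exact ⟨k, h ▸ hS (Nat.lt_succ_self _), h.ge⟩
    refine ((hgd k t).continuousAt.continuousWithinAt).congr_of_eventuallyEq ?_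
      (hxg k ⟨hk1.le, hk2⟩)
    filter_upwards [Icc_mem_nhdsLE hk1] with s hs
    exact hxg k ⟨hs.1, hs.2.trans hk2⟩
  refine ⟨x, isTrajectory_of_hasDerivWithinAt (A := fun t => B (κ t)) (K := K) ?_
    (fun t _ => hB _) (fun t _ => hK _ (hB _)) ?_
    (fun t ht => (hright t ht).mono Set.Ioi_subset_Ici_self), fun k => ?_⟩
  · intro i j
    exact (measurable_from_nat (f := fun k => B k i j)).comp hκ_mono.measurable
  · intro t ht
    rcases (Set.mem_Ici.1 ht).lt_or_eq with h | h
    · have := (hleft t h).union (hright t ht).continuousWithinAt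
      exact this.mono fun s _ => le_total s t
    · subst h
      exact (hright 0 le_rfl).continuousWithinAt
  · rw [hxg k ⟨le_rfl, (hS (Nat.lt_succ_self _)).le⟩, hgk]

/-- Periodic trajectories: the propagator of a finite word of constant arcs can be iterated. -/
theorem exists_isTrajectory_periodic {d : ℕ} {𝒜 : Set (Matrix (Fin d) (Fin d) ℝ)}
    (hc : IsCompact 𝒜) {l : List (ℝ × Matrix (Fin d) (Fin d) ℝ)} (hl : l ≠ [])
    (hpos : ∀ p ∈ l, 0 < p.1) (hmem : ∀ p ∈ l, p.2 ∈ 𝒜) (v : Fin d → ℝ) :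
    ∃ x, IsTrajectory 𝒜 x ∧ ∀ j : ℕ, x (j * (l.map Prod.fst).sum) =
      ((l.map fun p => NormedSpace.exp (p.1 • p.2)).reverse.prod) ^ j *ᵥ v := by
  set m := l.length with hm
  have hm0 : 0 < m := List.length_pos_iff.2 hl
  set c : ℕ → ℝ × Matrix (Fin d) (Fin d) ℝ := fun k => l[k % m]'(Nat.mod_lt _ hm0) with hcdef
  have hcm : ∀ k, c k ∈ l := fun k => List.getElem_mem _
  set S : ℕ → ℝ := fun k => ∑ i ∈ Finset.range k, (c i).1 with hSdef
  set y : ℕ → Fin d → ℝ := fun k =>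
    Nat.rec v (fun k z => NormedSpace.exp ((c k).1 • (c k).2) *ᵥ z) k with hydef
  have hSs : ∀ k, S (k + 1) = S k + (c k).1 := fun k => Finset.sum_range_succ _ _
  have hys : ∀ k, y (k + 1) = NormedSpace.exp ((c k).1 • (c k).2) *ᵥ y k := fun k => rfl
  have hci : ∀ j i (hi : i < m), c (j * m + i) = l[i] := by
    intro j i hi
    have : (j * m + i) % m = i := by
      rw [mul_comm, Nat.mul_add_mod, Nat.mod_eq_of_lt hi]
    simp only [hcdef, this]
  -- Later arcs multiply on the left, hence the reversed product.
  have hblock : ∀ j i, i ≤ m →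
      S (j * m + i) = S (j * m) + ((l.take i).map Prod.fst).sum ∧
      y (j * m + i) =
        ((l.take i).map fun p => NormedSpace.exp (p.1 • p.2)).reverse.prod *ᵥ y (j * m) := by
    intro j i
    induction i with
    | zero => simp
    | succ i ih =>
      intro hi
      obtain ⟨h1, h2⟩ := ih (by omega)
      have hlt : i < l.length := by omega
      rw [← add_assoc, hSs, hys, h1, h2, hci j i hlt, List.take_succ_eq_append_getElem hlt]
      refine ⟨by simp [add_assoc, -List.map_take, -List.take_append_getElem], by simp [-List.map_take, -List.take_append_getElem]⟩
  have hfull : ∀ j : ℕ, S (j * m) = j * (l.map Prod.fst).sum ∧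
      y (j * m) = (l.map fun p => NormedSpace.exp (p.1 • p.2)).reverse.prod ^ j *ᵥ v := by
    intro j
    induction j with
    | zero => simp [hSdef, hydef]
    | succ j ih =>
      obtain ⟨h1, h2⟩ := hblock j m le_rfl
      rw [hm, List.take_length, ← hm] at h1 h2
      rw [Nat.succ_mul, h1, h2, ih.1, ih.2, mulVec_mulVec, ← pow_succ']
      push_cast
      exact ⟨by ring, rfl⟩
  have hTpos : 0 < (l.map Prod.fst).sum := by
    refine List.sum_pos _ (fun t ht => ?_) (by simpa using hl)
    obtain ⟨p, hp, rfl⟩ := List.mem_map.1 ht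
    exact hpos p hp
  have hSmono : StrictMono S := strictMono_nat_of_lt_succ fun k => by
    rw [hSs]
    exact lt_add_of_pos_right _ (hpos _ (hcm k))
  have hSt : Filter.Tendsto S Filter.atTop Filter.atTop := by
    refine Filter.tendsto_atTop_atTop_of_monotone hSmono.monotone fun b => ?_
    obtain ⟨j, hj⟩ := exists_nat_ge (b / (l.map Prod.fst).sum)
    exact ⟨j * m, by rw [(hfull j).1]; exact (div_le_iff₀ hTpos).1 hj⟩
  obtain ⟨x, hx, hxS⟩ := exists_isTrajectory_of_seq hc (S := S) (B := fun k => (c k).2) (y := y)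
    (by simp [hSdef]) hSmono hSt (fun k => hmem _ (hcm k)) (fun k => by
      rw [hys, hSs, add_sub_cancel_left])
  exact ⟨x, hx, fun j => by rw [← (hfull j).1, hxS, (hfull j).2]⟩

/-! ### Spectral consequences of bounded powers -/

theorem Complex.norm_le_one_of_pow_bounded {μ : ℂ} {C c : ℝ} (hc : 0 < c)
    (h : ∀ j : ℕ, ‖μ‖ ^ j * c ≤ C) : ‖μ‖ ≤ 1 := by
  by_contra! h1
  obtain ⟨j, hj⟩ := pow_unbounded_of_one_lt (C / c) h1
  exact absurd (h j) (not_le.2 ((div_lt_iff₀ hc).1 hj))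

/-- The orbit `μ ^ j • v` of a complex eigenvector is assembled from the real orbits of its real and
imaginary parts, both bounded. -/
theorem Matrix.norm_eigenvalue_le_one_of_pow_bounded {n : Type*} [Fintype n] [DecidableEq n]
    {P : Matrix n n ℝ} (hP : ∀ v : n → ℝ, ∃ C : ℝ, ∀ j : ℕ, ‖(P ^ j) *ᵥ v‖ ≤ C) {μ : ℂ}
    {v : n → ℂ} (hv : v ≠ 0) (hμ : P.map ((↑) : ℝ → ℂ) *ᵥ v = μ • v) : ‖μ‖ ≤ 1 := by
  obtain ⟨C₁, h₁⟩ := hP fun i => (v i).re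
  obtain ⟨C₂, h₂⟩ := hP fun i => (v i).im
  obtain ⟨i, hi⟩ := Function.ne_iff.1 hv
  have hpow : ∀ j : ℕ, (P ^ j).map ((↑) : ℝ → ℂ) *ᵥ v = μ ^ j • v := by
    intro j
    induction j with
    | zero => simp [Matrix.map_one]
    | succ j ih =>
      have : (P ^ (j + 1)).map ((↑) : ℝ → ℂ) = (P ^ j).map ((↑) : ℝ → ℂ) * P.map ((↑) : ℝ → ℂ) := by
        rw [pow_succ]
        exact Matrix.map_mul (f := Complex.ofRealHom)
      rw [this, ← mulVec_mulVec, hμ, mulVec_smul, ih, smul_smul, pow_succ']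
  refine Complex.norm_le_one_of_pow_bounded (C := C₁ + C₂) (norm_pos_iff.2 hi) fun j => ?_
  have hval : μ ^ j * v i = ((P ^ j *ᵥ fun i => (v i).re) i : ℂ) +
      ((P ^ j *ᵥ fun i => (v i).im) i : ℂ) * Complex.I := by
    have h := congrFun (hpow j) i
    rw [Pi.smul_apply, smul_eq_mul] at h
    rw [← h]
    simp only [mulVec, dotProduct, map_apply]
    push_cast
    rw [Finset.sum_mul, ← Finset.sum_add_distrib]
    refine Finset.sum_congr rfl fun k _ => ?_
    conv_lhs => rw [← Complex.re_add_im (v k)]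
    ring
  calc ‖μ‖ ^ j * ‖v i‖ = ‖μ ^ j * v i‖ := by rw [norm_mul, norm_pow]
    _ ≤ ‖(P ^ j *ᵥ fun i => (v i).re) i‖ + ‖(P ^ j *ᵥ fun i => (v i).im) i‖ := by
      rw [hval]
      refine (norm_add_le _ _).trans (le_of_eq ?_)
      simp
    _ ≤ C₁ + C₂ := add_le_add ((norm_le_pi_norm _ i).trans (h₁ j))
      ((norm_le_pi_norm _ i).trans (h₂ j))

/-- A real `2 × 2` matrix with bounded powers satisfies `|det (l - P)| ≥ (l - 1)²` for `l ≥ 1`. -/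
theorem Matrix.sq_le_abs_det_of_pow_bounded {P : Matrix (Fin 2) (Fin 2) ℝ}
    (hP : ∀ v : Fin 2 → ℝ, ∃ C : ℝ, ∀ j : ℕ, ‖(P ^ j) *ᵥ v‖ ≤ C) {l : ℝ} (hl : 1 ≤ l) :
    (l - 1) ^ 2 ≤ |(l • (1 : Matrix (Fin 2) (Fin 2) ℝ) - P).det| := by
  -- A complex square root of the discriminant, so that the eigenvalues are `(trace ± s) / 2`, each
  -- at distance at least `l - 1` from `l`.
  obtain ⟨s, hs⟩ := IsAlgClosed.exists_eq_mul_self ((P.trace : ℂ) ^ 2 - 4 * P.det)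
  have hroot : ∀ μ : ℂ, μ ^ 2 - P.trace * μ + P.det = 0 → l - 1 ≤ ‖(l : ℂ) - μ‖ := by
    intro μ hμ
    have hdet : (μ • (1 : Matrix (Fin 2) (Fin 2) ℂ) - P.map ((↑) : ℝ → ℂ)).det = 0 := by
      rw [← hμ, det_fin_two, det_fin_two, trace_fin_two]
      simp
      ring
    obtain ⟨v, hv, hv0⟩ := Matrix.exists_mulVec_eq_zero_iff.2 hdet
    have h1 : ‖μ‖ ≤ 1 := by
      refine norm_eigenvalue_le_one_of_pow_bounded hP hv ?_
      rw [sub_mulVec, smul_mulVec, one_mulVec, sub_eq_zero] at hv0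
      exact hv0.symm
    have h2 := norm_sub_norm_le (l : ℂ) μ
    rw [Complex.norm_real, Real.norm_of_nonneg (by linarith)] at h2
    linarith
  have h1 := hroot ((P.trace + s) / 2) (by linear_combination -hs / 4)
  have h2 := hroot ((P.trace - s) / 2) (by linear_combination -hs / 4)
  have hfac : (((l • (1 : Matrix (Fin 2) (Fin 2) ℝ) - P).det : ℝ) : ℂ) =
      ((l : ℂ) - (P.trace + s) / 2) * ((l : ℂ) - (P.trace - s) / 2) := by
    have : (l • (1 : Matrix (Fin 2) (Fin 2) ℝ) - P).det = l ^ 2 - P.trace * l + P.det := by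
      rw [det_fin_two, det_fin_two, trace_fin_two]
      simp
      ring
    rw [this]
    push_cast
    linear_combination -hs / 4
  rw [← Real.norm_eq_abs, ← Complex.norm_real, hfac, norm_mul, sq]
  exact mul_le_mul h1 h2 (by linarith) (norm_nonneg _)

/-! ### The Lie product formula -/

theorem norm_pow_sub_pow_le_of_norm_le {𝔸 : Type*} [NormedRing 𝔸] [NormOneClass 𝔸] {a b : 𝔸}
    {c : ℝ} (ha : ‖a‖ ≤ c) (hb : ‖b‖ ≤ c) (hc : 1 ≤ c) (n : ℕ) :
    ‖a ^ n - b ^ n‖ ≤ n * c ^ n * ‖a - b‖ := by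
  induction n with
  | zero => simp
  | succ n ih =>
    have hcn : c ^ n ≤ c ^ (n + 1) := pow_le_pow_right₀ hc (Nat.le_succ n)
    calc ‖a ^ (n + 1) - b ^ (n + 1)‖ = ‖a * (a ^ n - b ^ n) + (a - b) * b ^ n‖ := by
          rw [pow_succ' a, pow_succ' b]; congr 1; noncomm_ring
      _ ≤ ‖a‖ * ‖a ^ n - b ^ n‖ + ‖a - b‖ * ‖b‖ ^ n := by
          refine (norm_add_le _ _).trans (add_le_add (norm_mul_le _ _) ((norm_mul_le _ _).trans ?_))
          gcongr
          exact norm_pow_le b n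
      _ ≤ c * (n * c ^ n * ‖a - b‖) + ‖a - b‖ * c ^ (n + 1) := by
          gcongr
          exact (pow_le_pow_left₀ (norm_nonneg _) hb n).trans hcn
      _ = _ := by push_cast; ring

/-- If `F 0 = 1` and `F' 0 = Z`, then `F (1 / n) ^ n` tends to `exp Z`. -/
theorem HasDerivAt.tendsto_pow_exp {𝔸 : Type*} [NormedRing 𝔸] [NormOneClass 𝔸]
    [NormedAlgebra ℝ 𝔸] [CompleteSpace 𝔸] {F : ℝ → 𝔸} {Z : 𝔸} (hF : HasDerivAt F Z 0)
    (hF0 : F 0 = 1) :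
    Filter.Tendsto (fun n : ℕ => F ((n : ℝ)⁻¹) ^ n) Filter.atTop (nhds (NormedSpace.exp Z)) := by
  have bound : ∀ {H : ℝ → 𝔸}, HasDerivAt H Z 0 → H 0 = 1 →
      ∀ᶠ n : ℕ in Filter.atTop, ‖H ((n : ℝ)⁻¹)‖ ≤ 1 + (‖Z‖ + 1) * (n : ℝ)⁻¹ := by
    intro H hH hH0
    have := hH.isLittleO.def (zero_lt_one' ℝ)
    have h2 := tendsto_inv_atTop_nhds_zero_nat (𝕜 := ℝ) |>.eventually this
    filter_upwards [h2] with n hn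
    rw [hH0, sub_zero, one_mul] at hn
    have hnn : (0 : ℝ) ≤ (n : ℝ)⁻¹ := by positivity
    rw [Real.norm_of_nonneg hnn] at hn
    calc ‖H ((n : ℝ)⁻¹)‖ = ‖1 + (n : ℝ)⁻¹ • Z + (H ((n : ℝ)⁻¹) - 1 - (n : ℝ)⁻¹ • Z)‖ := by
          congr 1; abel
      _ ≤ ‖(1 : 𝔸)‖ + ‖(n : ℝ)⁻¹ • Z‖ + (n : ℝ)⁻¹ :=
          (norm_add_le _ _).trans (add_le_add (norm_add_le _ _) hn)
      _ = _ := by rw [norm_one, norm_smul, Real.norm_of_nonneg hnn]; ring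
  set G : ℝ → 𝔸 := fun t => NormedSpace.exp (t • Z) with hG
  have hGd : HasDerivAt G Z 0 := by
    simpa using hasDerivAt_exp_smul_const (𝕂 := ℝ) Z 0
  have hG0 : G 0 = 1 := by simp [hG]
  have hGn : ∀ n : ℕ, n ≠ 0 → G ((n : ℝ)⁻¹) ^ n = NormedSpace.exp Z := by
    intro n hn
    let : NormedAlgebra ℚ 𝔸 := .restrictScalars ℚ ℝ 𝔸
    rw [hG, ← NormedSpace.exp_nsmul, ← Nat.cast_smul_eq_nsmul ℝ, smul_smul,
      mul_inv_cancel₀ (by exact_mod_cast hn), one_smul]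
  -- `F` and `G` have the same value and derivative at 0, so they differ by `o(1/n)` at `1/n`;
  -- taking `n`-th powers multiplies the error by at most a constant times `n`.
  have hdiff : Filter.Tendsto (fun n : ℕ => (n : ℝ) * ‖F ((n : ℝ)⁻¹) - G ((n : ℝ)⁻¹)‖)
      Filter.atTop (nhds 0) := by
    have h := (hF.sub hGd).isLittleO
    simp only [Pi.sub_apply, hF0, hG0, sub_self, sub_zero, smul_zero] at h
    have h2 := (h.comp_tendsto (tendsto_inv_atTop_nhds_zero_nat (𝕜 := ℝ))).norm_left
    have h3 := h2.tendsto_div_nhds_zero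
    refine h3.congr fun n => ?_
    simp [div_eq_mul_inv, mul_comm]
  rw [tendsto_iff_norm_sub_tendsto_zero]
  refine squeeze_zero' (g := fun n : ℕ => Real.exp (‖Z‖ + 1) *
    ((n : ℝ) * ‖F ((n : ℝ)⁻¹) - G ((n : ℝ)⁻¹)‖)) (.of_forall fun n => norm_nonneg _) ?_
    (by simpa using hdiff.const_mul _)
  filter_upwards [bound hF hF0, bound hGd hG0, Filter.eventually_ne_atTop 0] with n h1 h2 hn
  have hn' : (n : ℝ) ≠ 0 := by exact_mod_cast hn
  rw [← hGn n hn]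
  refine (norm_pow_sub_pow_le_of_norm_le h1 h2 (le_add_of_nonneg_right (by positivity)) n).trans ?_
  have : (1 + (‖Z‖ + 1) * (n : ℝ)⁻¹) ^ n ≤ Real.exp (‖Z‖ + 1) := by
    calc (1 + (‖Z‖ + 1) * (n : ℝ)⁻¹) ^ n ≤ Real.exp ((‖Z‖ + 1) * (n : ℝ)⁻¹) ^ n := by
          gcongr
          rw [add_comm]
          exact Real.add_one_le_exp _
      _ = _ := by rw [← Real.exp_nat_mul]; congr 1; field_simp
  rw [mul_comm (n : ℝ), mul_assoc]
  gcongr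

section
open scoped Matrix.Norms.Operator

/-- In a closed submonoid of matrices, the generators of one-parameter semigroups form a convex
set, by the Lie product formula. -/
theorem Matrix.convex_setOf_exp_mem {n : Type*} [Fintype n] [DecidableEq n] [Nonempty n]
    {S : Submonoid (Matrix n n ℝ)} (hS : IsClosed (S : Set (Matrix n n ℝ))) :
    Convex ℝ {B : Matrix n n ℝ | ∀ t : ℝ, 0 ≤ t → NormedSpace.exp (t • B) ∈ S} := by
  intro X hX Y hY a b ha hb _ t ht
  set F : ℝ → Matrix n n ℝ := fun h =>
    NormedSpace.exp (h • ((t * a) • X)) * NormedSpace.exp (h • ((t * b) • Y)) with hF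
  have hFd : HasDerivAt F (t • (a • X + b • Y)) 0 := by
    have h := (hasDerivAt_exp_smul_const (𝕂 := ℝ) ((t * a) • X) 0).mul
      (hasDerivAt_exp_smul_const (𝕂 := ℝ) ((t * b) • Y) 0)
    refine h.congr_deriv ?_
    simp [smul_smul]
  refine hS.mem_of_tendsto (hFd.tendsto_pow_exp (by simp [hF])) (.of_forall fun k => ?_)
  refine S.pow_mem (S.mul_mem ?_ ?_) k
  · rw [smul_smul]
    exact hX _ (by positivity)
  · rw [smul_smul]
    exact hY _ (by positivity)

end

/-! ### Normalized propagators and their closure -/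

/-- The submonoid generated by the propagators `exp (t (A - s))`, `A ∈ 𝒜`, `t ≥ 0`. -/
def propagatorMonoid {d : ℕ} (𝒜 : Set (Matrix (Fin d) (Fin d) ℝ)) (s : ℝ) :
    Submonoid (Matrix (Fin d) (Fin d) ℝ) :=
  Submonoid.closure {P | ∃ A ∈ 𝒜, ∃ t : ℝ, 0 ≤ t ∧
    P = NormedSpace.exp (t • (A - s • (1 : Matrix (Fin d) (Fin d) ℝ)))}

section
open scoped Matrix.Norms.Operator

theorem Matrix.exp_smul_sub_smul_one {n : Type*} [Fintype n] [DecidableEq n] (A : Matrix n n ℝ)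
    (s t : ℝ) : NormedSpace.exp (t • (A - s • (1 : Matrix n n ℝ))) =
      Real.exp (-(s * t)) • NormedSpace.exp (t • A) := by
  have h1 : t • (A - s • (1 : Matrix n n ℝ)) = algebraMap ℝ (Matrix n n ℝ) (-(s * t)) + t • A := by
    rw [Algebra.algebraMap_eq_smul_one, smul_sub, smul_smul, neg_smul, mul_comm t s]
    abel
  have h2 : NormedSpace.exp (algebraMap ℝ (Matrix n n ℝ) (-(s * t))) =
      algebraMap ℝ (Matrix n n ℝ) (Real.exp (-(s * t))) := by
    rw [Real.exp_eq_exp_ℝ]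
    exact (NormedSpace.algebraMap_exp_comm _).symm
  rw [h1, Matrix.exp_add_of_commute _ _ (Algebra.commute_algebraMap_left _ _), h2, Algebra.algebraMap_eq_smul_one,
    smul_mul_assoc, one_mul]

end

/-- Arcs of zero length are dropped, because periodic concatenation needs strictly increasing
switching times. -/
theorem exists_list_of_mem_propagatorMonoid {d : ℕ} {𝒜 : Set (Matrix (Fin d) (Fin d) ℝ)} {s : ℝ}
    {P : Matrix (Fin d) (Fin d) ℝ} (hP : P ∈ propagatorMonoid 𝒜 s) :
    ∃ l : List (ℝ × Matrix (Fin d) (Fin d) ℝ), (∀ p ∈ l, 0 < p.1) ∧ (∀ p ∈ l, p.2 ∈ 𝒜) ∧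
      P = Real.exp (-(s * (l.map Prod.fst).sum)) •
        (l.map fun p => NormedSpace.exp (p.1 • p.2)).reverse.prod := by
  induction hP using Submonoid.closure_induction with
  | mem P hP =>
    obtain ⟨A, hA, t, ht, rfl⟩ := hP
    rcases ht.eq_or_lt with rfl | ht
    · exact ⟨[], by simp⟩
    · exact ⟨[(t, A)], by simpa using ht, by simpa using hA, by
        simp [Matrix.exp_smul_sub_smul_one]⟩
  | one => exact ⟨[], by simp⟩
  | mul P Q _ _ hP hQ =>
    obtain ⟨l, h1, h2, rfl⟩ := hP
    obtain ⟨l', h1', h2', rfl⟩ := hQ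
    refine ⟨l' ++ l, ?_, ?_, ?_⟩
    · intro p hp
      exact (List.mem_append.1 hp).elim (h1' p) (h1 p)
    · intro p hp
      exact (List.mem_append.1 hp).elim (h2' p) (h2 p)
    · rw [smul_mul_smul_comm, ← Real.exp_add]
      simp only [List.map_append, List.sum_append, List.reverse_append, List.prod_append]
      congr 2
      ring

/-- If all trajectories grow at most as `exp (s t)`, then each normalized propagator has bounded
powers. -/
theorem pow_bounded_of_mem_propagatorMonoid {d : ℕ} {𝒜 : Set (Matrix (Fin d) (Fin d) ℝ)}
    (hc : IsCompact 𝒜) {s : ℝ}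
    (hs : ∀ x : ℝ → Fin d → ℝ, IsTrajectory 𝒜 x →
      ∃ C : ℝ, ∀ t, 0 ≤ t → ‖x t‖ ≤ C * Real.exp (s * t))
    {P : Matrix (Fin d) (Fin d) ℝ} (hP : P ∈ propagatorMonoid 𝒜 s) (v : Fin d → ℝ) :
    ∃ C : ℝ, ∀ j : ℕ, ‖(P ^ j) *ᵥ v‖ ≤ C := by
  obtain ⟨l, hpos, hmem, rfl⟩ := exists_list_of_mem_propagatorMonoid hP
  rcases eq_or_ne l [] with rfl | hl
  · exact ⟨‖v‖, by simp⟩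
  obtain ⟨x, hx, hxj⟩ := exists_isTrajectory_periodic hc hl hpos hmem v
  obtain ⟨C, hC⟩ := hs x hx
  have hT : 0 ≤ (l.map Prod.fst).sum := List.sum_nonneg fun t ht => by
    obtain ⟨p, hp, rfl⟩ := List.mem_map.1 ht
    exact (hpos p hp).le
  refine ⟨C, fun j => ?_⟩
  have h := hC (j * (l.map Prod.fst).sum) (by positivity)
  rw [hxj] at h
  rw [smul_pow, smul_mulVec, norm_smul, Real.norm_of_nonneg (by positivity), ← Real.exp_nat_mul]
  calc _ ≤ Real.exp (j * -(s * (l.map Prod.fst).sum)) *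
        (C * Real.exp (s * (j * (l.map Prod.fst).sum))) := by gcongr
    _ = C * Real.exp (j * -(s * (l.map Prod.fst).sum) + s * (j * (l.map Prod.fst).sum)) := by
      rw [Real.exp_add]; ring
    _ = C := by ring_nf; simp

theorem continuous_det_smul_one_sub {n : Type*} [Fintype n] [DecidableEq n] (l : ℝ) :
    Continuous fun P : Matrix n n ℝ => |(l • (1 : Matrix n n ℝ) - P).det| := by
  fun_prop

/-- Semigroup generators in a closed monoid form a convex set, and the shift by `s` is affine, so
membership passes from `𝒜` to its hull. -/
theorem exp_mem_closure_propagatorMonoid {𝒜 : Set (Matrix (Fin 2) (Fin 2) ℝ)} {s : ℝ}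
    {A : Matrix (Fin 2) (Fin 2) ℝ} (hA : A ∈ convexHull ℝ 𝒜) {t : ℝ} (ht : 0 ≤ t) :
    Real.exp (-(s * t)) • NormedSpace.exp (t • A) ∈
      (propagatorMonoid 𝒜 s).topologicalClosure := by
  set S := (propagatorMonoid 𝒜 s).topologicalClosure
  have hconv := Matrix.convex_setOf_exp_mem (S := S)
    (Submonoid.isClosed_topologicalClosure _)
  have hconv' : Convex ℝ {B : Matrix (Fin 2) (Fin 2) ℝ |
      ∀ t : ℝ, 0 ≤ t → NormedSpace.exp (t • (B - s • (1 : Matrix (Fin 2) (Fin 2) ℝ))) ∈ S} := by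
    intro B hB C hC a b ha hb hab
    have h : a • B + b • C - s • (1 : Matrix (Fin 2) (Fin 2) ℝ) =
        a • (B - s • (1 : Matrix (Fin 2) (Fin 2) ℝ)) +
          b • (C - s • (1 : Matrix (Fin 2) (Fin 2) ℝ)) := by
      conv_lhs => rw [← one_smul ℝ (s • (1 : Matrix (Fin 2) (Fin 2) ℝ)), ← hab]
      module
    intro t ht
    rw [h]
    exact hconv hB hC ha hb hab t ht
  have hsub := convexHull_min (s := 𝒜) (fun B hB t ht => (propagatorMonoid 𝒜 s).le_topologicalClosure
    (Submonoid.subset_closure ⟨B, hB, t, ht, rfl⟩)) hconv'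
  rw [← Matrix.exp_smul_sub_smul_one]
  exact hsub hA t ht

/-- Two consecutive arcs of the convexified system cannot expand faster than `exp (s t)`. -/
theorem sq_le_abs_det_sub_exp_mul_exp {𝒜 : Set (Matrix (Fin 2) (Fin 2) ℝ)} (hc : IsCompact 𝒜)
    {s : ℝ}
    (hs : ∀ x : ℝ → Fin 2 → ℝ, IsTrajectory 𝒜 x →
      ∃ C : ℝ, ∀ t, 0 ≤ t → ‖x t‖ ≤ C * Real.exp (s * t))
    {A B : Matrix (Fin 2) (Fin 2) ℝ} (hA : A ∈ convexHull ℝ 𝒜) (hB : B ∈ convexHull ℝ 𝒜)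
    {t r : ℝ} (ht : 0 ≤ t) (hr : 0 ≤ r) {l : ℝ} (hl : 1 ≤ l) :
    (l - 1) ^ 2 ≤ |(l • (1 : Matrix (Fin 2) (Fin 2) ℝ) -
      (Real.exp (-(s * t)) • NormedSpace.exp (t • A)) *
        (Real.exp (-(s * r)) • NormedSpace.exp (r • B))).det| := by
  have hmem := (propagatorMonoid 𝒜 s).topologicalClosure.mul_mem
    (exp_mem_closure_propagatorMonoid hA ht) (exp_mem_closure_propagatorMonoid hB hr)
  -- Bounded powers need not survive a limit; the determinant inequality they imply does.
  have hcl : IsClosed {P : Matrix (Fin 2) (Fin 2) ℝ |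
      (l - 1) ^ 2 ≤ |(l • (1 : Matrix (Fin 2) (Fin 2) ℝ) - P).det|} :=
    isClosed_le continuous_const (continuous_det_smul_one_sub l)
  refine closure_minimal (s := (propagatorMonoid 𝒜 s : Set (Matrix (Fin 2) (Fin 2) ℝ)))
    (fun P hP => ?_) hcl hmem
  exact Matrix.sq_le_abs_det_of_pow_bounded
    (fun v => pow_bounded_of_mem_propagatorMonoid hc hs hP v) hl

/-! ### Rotations `exp (θ J)` and their invariant forms -/

section
open scoped Matrix.Norms.Operator

/-- The algebra map from `ℂ` sending `i` to `J` is continuous and carries Euler's formula to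
matrices. -/
theorem Matrix.exp_smul_of_mul_self_eq_neg_one {n : Type*} [Fintype n] [DecidableEq n]
    {J : Matrix n n ℝ} (hJ : J * J = -1) (θ : ℝ) :
    NormedSpace.exp (θ • J) = Real.cos θ • (1 : Matrix n n ℝ) + Real.sin θ • J := by
  let φ := Complex.liftAux J hJ
  have hφ : Continuous φ := LinearMap.continuous_of_finiteDimensional φ.toLinearMap
  have h := NormedSpace.map_exp φ hφ ((θ : ℂ) * Complex.I)
  rw [← Complex.exp_eq_exp_ℂ, Complex.liftAux_apply, Complex.liftAux_apply,
    Complex.exp_ofReal_mul_I_re, Complex.exp_ofReal_mul_I_im] at h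
  have hre : ((θ : ℂ) * Complex.I).re = 0 := by simp
  have him : ((θ : ℂ) * Complex.I).im = θ := by simp
  rw [hre, him, map_zero, zero_add, Algebra.algebraMap_eq_smul_one] at h
  exact h.symm

end

theorem Real.exists_nonneg_cos_sin {a b : ℝ} (h : a ^ 2 + b ^ 2 = 1) :
    ∃ θ : ℝ, 0 ≤ θ ∧ Real.cos θ = a ∧ Real.sin θ = b := by
  have hn : ‖(⟨a, b⟩ : ℂ)‖ = 1 := by
    rw [Complex.norm_def, Complex.normSq_mk, ← sq, ← sq, h, Real.sqrt_one]
  refine ⟨Complex.arg ⟨a, b⟩ + 2 * Real.pi, ?_, ?_, ?_⟩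
  -- Adding `2π` makes the angle nonnegative, as it will serve as a running time.
  · linarith [Complex.neg_pi_lt_arg ⟨a, b⟩, Real.pi_pos]
  · simpa [hn] using Complex.norm_mul_cos_arg ⟨a, b⟩
  · simpa [hn] using Complex.sin_arg ⟨a, b⟩

/-- `N` is skew-adjoint with respect to the bilinear form of `M`. -/
theorem Matrix.dotProduct_mulVec_skew {n : Type*} [Fintype n] {M N : Matrix n n ℝ}
    (hM : M.IsHermitian) (h : ∀ v, v ⬝ᵥ M *ᵥ (N *ᵥ v) = 0) (v w : n → ℝ) :
    (N *ᵥ v) ⬝ᵥ M *ᵥ w = -(v ⬝ᵥ M *ᵥ (N *ᵥ w)) := by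
  have := h (v + w)
  simp only [mulVec_add, dotProduct_add, add_dotProduct, h] at this
  rw [hM.dotProduct_mulVec_comm (N *ᵥ v)]
  linarith

theorem Matrix.quadraticForm_mulVec_of_skew {n : Type*} [Fintype n] [DecidableEq n]
    {J M : Matrix n n ℝ} (hJ : J * J = -1) (hM : M.IsHermitian)
    (h : ∀ v, v ⬝ᵥ M *ᵥ (J *ᵥ v) = 0) (x : n → ℝ) :
    (J *ᵥ x) ⬝ᵥ M *ᵥ (J *ᵥ x) = x ⬝ᵥ M *ᵥ x := by
  rw [dotProduct_mulVec_skew hM h, mulVec_mulVec _ J J, hJ, neg_mulVec, one_mulVec, mulVec_neg,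
    dotProduct_neg, neg_neg]

/-- `J` has no real eigenvector, so `x` and `J x` form a basis; the coefficients come from Cramer's
rule. -/
theorem Matrix.exists_combination_of_mul_self_eq_neg_one {J : Matrix (Fin 2) (Fin 2) ℝ}
    (hJ : J * J = -1) {x : Fin 2 → ℝ} (hx : x ≠ 0) (y : Fin 2 → ℝ) :
    ∃ a b : ℝ, y = a • x + b • (J *ᵥ x) := by
  have h00 := congrFun (congrFun hJ 0) 0
  have h01 := congrFun (congrFun hJ 0) 1
  have h10 := congrFun (congrFun hJ 1) 0
  have h11 := congrFun (congrFun hJ 1) 1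
  simp [mul_apply, Fin.sum_univ_two] at h00 h01 h10 h11
  have htr : J 0 0 + J 1 1 = 0 := by
    by_contra hne
    have h1 : J 0 1 = 0 := by
      have : J 0 1 * (J 0 0 + J 1 1) = 0 := by linarith
      exact (mul_eq_zero.1 this).resolve_right hne
    rw [h1] at h00
    nlinarith [sq_nonneg (J 0 0)]
  have e11 : J 1 1 = -J 0 0 := by linarith
  set D := x 0 * (J 1 0 * x 0 + J 1 1 * x 1) - x 1 * (J 0 0 * x 0 + J 0 1 * x 1) with hDdef
  have hD : D ≠ 0 := by
    intro h0
    -- `D` is the determinant of the pair `x`, `J x`; completing the square with `tr J = 0` and `det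
    -- J = 1` shows that it can vanish only at `x = 0`.
    have hsq : (J 1 0 * x 0 - J 0 0 * x 1) ^ 2 + x 1 ^ 2 = J 1 0 * D := by
      rw [hDdef, e11]
      linear_combination x 1 ^ 2 * h00
    rw [h0, mul_zero] at hsq
    have hx1 : x 1 = 0 := by nlinarith [sq_nonneg (J 1 0 * x 0 - J 0 0 * x 1), sq_nonneg (x 1)]
    rw [hx1] at hsq
    have hx0' : J 1 0 * x 0 = 0 := by nlinarith [sq_nonneg (J 1 0 * x 0)]
    have hx0 : x 0 = 0 := by
      rcases mul_eq_zero.1 hx0' with h | h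
      · rw [h] at h00
        nlinarith [sq_nonneg (J 0 0)]
      · exact h
    exact hx (by ext i; fin_cases i <;> simp [hx0, hx1])
  refine ⟨(y 0 * (J 1 0 * x 0 + J 1 1 * x 1) - y 1 * (J 0 0 * x 0 + J 0 1 * x 1)) / D,
    (x 0 * y 1 - x 1 * y 0) / D, ?_⟩
  ext i
  fin_cases i
  · simp
    field_simp
    rw [hDdef]
    ring
  · simp
    field_simp
    rw [hDdef]
    ring

/-- The rotations `exp (θ J)`, `θ ≥ 0`, act transitively on the ellipses of an invariant
quadratic form. -/
theorem Matrix.exists_exp_mulVec_eq {J M : Matrix (Fin 2) (Fin 2) ℝ} (hJ : J * J = -1)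
    (hM : M.PosDef) (h : ∀ v, v ⬝ᵥ M *ᵥ (J *ᵥ v) = 0) {x y : Fin 2 → ℝ}
    (hxy : x ⬝ᵥ M *ᵥ x = y ⬝ᵥ M *ᵥ y) :
    ∃ θ : ℝ, 0 ≤ θ ∧ NormedSpace.exp (θ • J) *ᵥ x = y := by
  have hpos : ∀ v : Fin 2 → ℝ, v ≠ 0 → 0 < v ⬝ᵥ M *ᵥ v := fun v hv => by
    simpa using hM.dotProduct_mulVec_pos hv
  rcases eq_or_ne x 0 with rfl | hx
  · refine ⟨0, le_rfl, ?_⟩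
    by_contra hy
    have := hpos y (by simpa [eq_comm] using hy)
    rw [← hxy] at this
    simp at this
  obtain ⟨a, b, hab⟩ := exists_combination_of_mul_self_eq_neg_one hJ hx y
  have hJx := quadraticForm_mulVec_of_skew hJ hM.1 h x
  have hJx' : (J *ᵥ x) ⬝ᵥ M *ᵥ x = 0 := by rw [dotProduct_mulVec_skew hM.1 h, h, neg_zero]
  have hsq : a ^ 2 + b ^ 2 = 1 := by
    have : (a ^ 2 + b ^ 2) * (x ⬝ᵥ M *ᵥ x) = 1 * (x ⬝ᵥ M *ᵥ x) := by
      conv_rhs => rw [one_mul, hxy, hab]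
      simp only [mulVec_add, dotProduct_add, add_dotProduct, mulVec_smul, dotProduct_smul,
        smul_dotProduct, smul_eq_mul, h, hJx, hJx']
      ring
    exact mul_right_cancel₀ (hpos x hx).ne' this
  obtain ⟨θ, hθ, hc, hs⟩ := Real.exists_nonneg_cos_sin hsq
  refine ⟨θ, hθ, ?_⟩
  rw [exp_smul_of_mul_self_eq_neg_one hJ, hc, hs, add_mulVec, smul_mulVec, smul_mulVec, one_mulVec,
    ← hab]

theorem Matrix.quadraticForm_exp_mulVec {n : Type*} [Fintype n] [DecidableEq n]
    {J M : Matrix n n ℝ} (hJ : J * J = -1)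
    (hM : M.IsHermitian) (h : ∀ v, v ⬝ᵥ M *ᵥ (J *ᵥ v) = 0) (θ : ℝ) (x : n → ℝ) :
    (NormedSpace.exp (θ • J) *ᵥ x) ⬝ᵥ M *ᵥ (NormedSpace.exp (θ • J) *ᵥ x) = x ⬝ᵥ M *ᵥ x := by
  have hJx := quadraticForm_mulVec_of_skew hJ hM h x
  have hJx' : (J *ᵥ x) ⬝ᵥ M *ᵥ x = 0 := by rw [dotProduct_mulVec_skew hM h, h, neg_zero]
  rw [exp_smul_of_mul_self_eq_neg_one hJ, add_mulVec, smul_mulVec, smul_mulVec, one_mulVec]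
  simp only [mulVec_add, dotProduct_add, add_dotProduct, mulVec_smul, dotProduct_smul,
    smul_dotProduct, smul_eq_mul, h, hJx, hJx']
  linear_combination (x ⬝ᵥ M *ᵥ x) * Real.cos_sq_add_sin_sq θ

/-- A quadratic form that is nonincreasing along the flow of `J`, `J² = -1`, is invariant. -/
theorem Matrix.dotProduct_mulVec_eq_zero_of_nonpos {n : Type*} [Fintype n] [DecidableEq n]
    {J M : Matrix n n ℝ} (hJ : J * J = -1) (hM : M.IsHermitian)
    (h : ∀ v, v ⬝ᵥ M *ᵥ (J *ᵥ v) ≤ 0) (v : n → ℝ) : v ⬝ᵥ M *ᵥ (J *ᵥ v) = 0 := by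
  refine le_antisymm (h v) ?_
  have h2 := h (J *ᵥ v)
  rw [mulVec_mulVec _ J J, hJ, neg_mulVec, one_mulVec, mulVec_neg, dotProduct_neg,
    hM.dotProduct_mulVec_comm] at h2
  linarith

theorem Matrix.PosDef.exists_norm_sq_le {n : Type*} [Fintype n] {M : Matrix n n ℝ}
    (hM : M.PosDef) : ∃ C : ℝ, 0 ≤ C ∧ ∀ x : n → ℝ, ‖x‖ ^ 2 ≤ C * (x ⬝ᵥ M *ᵥ x) := by
  have hpos : ∀ v : n → ℝ, v ≠ 0 → 0 < v ⬝ᵥ M *ᵥ v := fun v hv => by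
    simpa using hM.dotProduct_mulVec_pos hv
  have hcont : ContinuousOn (fun v : n → ℝ => (v ⬝ᵥ M *ᵥ v)⁻¹) (Metric.sphere 0 1) := by
    refine ContinuousOn.inv₀ (by fun_prop) fun v hv => (hpos v ?_).ne'
    rintro rfl
    simp at hv
  obtain ⟨C, hC⟩ := (isCompact_sphere (0 : n → ℝ) 1).exists_bound_of_continuousOn hcont
  refine ⟨|C|, abs_nonneg C, fun x => ?_⟩
  rcases eq_or_ne x 0 with rfl | hx
  · simp
  have hn : 0 < ‖x‖ := norm_pos_iff.2 hx
  have h1 := (le_abs_self _).trans ((hC (‖x‖⁻¹ • x) (by simp [norm_smul, hn.ne'])).trans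
    (le_abs_self C))
  simp only [mulVec_smul, dotProduct_smul, smul_dotProduct, smul_eq_mul] at h1
  have hq := hpos x hx
  have e : (‖x‖⁻¹ * (‖x‖⁻¹ * (x ⬝ᵥ M *ᵥ x)))⁻¹ = ‖x‖ ^ 2 / (x ⬝ᵥ M *ᵥ x) := by
    field_simp
  rw [e, div_le_iff₀ hq] at h1
  exact h1

/-! ### Non-real spectra of planar matrices -/

theorem mem_complexSpectrum_fin_two {A : Matrix (Fin 2) (Fin 2) ℝ} {z : ℂ} :
    z ∈ complexSpectrum A ↔ z ^ 2 - A.trace * z + A.det = 0 := by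
  rw [complexSpectrum, Matrix.mem_spectrum_iff_isRoot_charpoly, charpoly_fin_two]
  simp [Polynomial.IsRoot, trace_fin_two, det_fin_two]

theorem trace_det_of_mem_complexSpectrum {A : Matrix (Fin 2) (Fin 2) ℝ} {z : ℂ}
    (hz : z ∈ complexSpectrum A) (him : z.im ≠ 0) :
    A.trace = 2 * z.re ∧ A.det = z.re ^ 2 + z.im ^ 2 := by
  rw [mem_complexSpectrum_fin_two] at hz
  have h1 := congrArg Complex.re hz
  have h2 := congrArg Complex.im hz
  simp [sq] at h1 h2
  have htr : A.trace = 2 * z.re := by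
    have : z.im * (A.trace - 2 * z.re) = 0 := by linarith
    linarith [(mul_eq_zero.1 this).resolve_left him]
  exact ⟨htr, by rw [htr] at h1; linarith⟩

theorem complexSpectrum_eq_pair {A : Matrix (Fin 2) (Fin 2) ℝ} {α β : ℝ} (htr : A.trace = 2 * α)
    (hdet : A.det = α ^ 2 + β ^ 2) :
    complexSpectrum A = {(α : ℂ) + β * Complex.I, (α : ℂ) - β * Complex.I} := by
  ext z
  rw [mem_complexSpectrum_fin_two, htr, hdet]
  have : z ^ 2 - ((2 * α : ℝ) : ℂ) * z + ((α ^ 2 + β ^ 2 : ℝ) : ℂ) =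
      (z - (α + β * Complex.I)) * (z - (α - β * Complex.I)) := by
    push_cast
    linear_combination (β ^ 2 : ℂ) * Complex.I_sq
  rw [this, mul_eq_zero, sub_eq_zero, sub_eq_zero]
  rfl

/-- A real `2 × 2` matrix with non-real eigenvalues is `α + b J` with `b > 0` and `J² = -1`. -/
theorem exists_eq_add_smul_of_mem_complexSpectrum {A : Matrix (Fin 2) (Fin 2) ℝ} {z : ℂ}
    (hz : z ∈ complexSpectrum A) (him : z.im ≠ 0) :
    ∃ b : ℝ, 0 < b ∧ ∃ J : Matrix (Fin 2) (Fin 2) ℝ, J * J = -1 ∧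
      A - z.re • (1 : Matrix (Fin 2) (Fin 2) ℝ) = b • J := by
  obtain ⟨htr, hdet⟩ := trace_det_of_mem_complexSpectrum hz him
  rw [trace_fin_two] at htr
  rw [det_fin_two] at hdet
  have hb : 0 < |z.im| := abs_pos.2 him
  refine ⟨|z.im|, hb, |z.im|⁻¹ • (A - z.re • (1 : Matrix (Fin 2) (Fin 2) ℝ)), ?_, ?_⟩
  · have hsq : (A - z.re • (1 : Matrix (Fin 2) (Fin 2) ℝ)) *
        (A - z.re • (1 : Matrix (Fin 2) (Fin 2) ℝ)) =
        -(|z.im| ^ 2 • (1 : Matrix (Fin 2) (Fin 2) ℝ)) := by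
      rw [sq_abs]
      have e : A 1 1 = 2 * z.re - A 0 0 := by linarith
      rw [e] at hdet
      ext i j
      fin_cases i <;> fin_cases j <;> simp [mul_apply, Fin.sum_univ_two, e] <;>
        first | linear_combination -hdet | ring
    rw [smul_mul_smul_comm, hsq, smul_neg, smul_smul]
    have : |z.im|⁻¹ * |z.im|⁻¹ * |z.im| ^ 2 = 1 := by field_simp
    rw [this, one_smul]
  · rw [smul_smul, mul_inv_cancel₀ hb.ne', one_smul]

theorem exp_smul_eq_exp_smul_rotation {A J : Matrix (Fin 2) (Fin 2) ℝ} {α b : ℝ}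
    (h : A - α • (1 : Matrix (Fin 2) (Fin 2) ℝ) = b • J) (t : ℝ) :
    NormedSpace.exp (t • A) = Real.exp (α * t) • NormedSpace.exp ((t * b) • J) := by
  rw [← smul_smul, ← h, Matrix.exp_smul_sub_smul_one, smul_smul, ← Real.exp_add, add_neg_cancel,
    Real.exp_zero, one_smul]

/-! ### Matrix inequalities and the Lyapunov exponent -/

theorem SolvesLMI.dotProduct_le {d : ℕ} {𝒜 : Set (Matrix (Fin d) (Fin d) ℝ)} {α : ℝ}
    {M : Matrix (Fin d) (Fin d) ℝ} (h : SolvesLMI 𝒜 α M) {A : Matrix (Fin d) (Fin d) ℝ}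
    (hA : A ∈ 𝒜) (v : Fin d → ℝ) : v ⬝ᵥ M *ᵥ (A *ᵥ v) ≤ α * (v ⬝ᵥ M *ᵥ v) := by
  have := (h.2 A hA).dotProduct_mulVec_nonneg v
  rw [star_trivial, dotProduct_sub_lyapunov A M h.1.1] at this
  linarith

theorem SolvesLMI.of_dotProduct_le {d : ℕ} {𝒜 : Set (Matrix (Fin d) (Fin d) ℝ)} {α : ℝ}
    {M : Matrix (Fin d) (Fin d) ℝ} (hM : M.PosDef)
    (h : ∀ A ∈ 𝒜, ∀ v, v ⬝ᵥ M *ᵥ (A *ᵥ v) ≤ α * (v ⬝ᵥ M *ᵥ v)) : SolvesLMI 𝒜 α M := by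
  refine ⟨hM, fun A hA => .of_dotProduct_mulVec_nonneg ?_ fun v => ?_⟩
  · have hT : Mᵀ = M := by rw [← conjTranspose_eq_transpose_of_trivial]; exact hM.1
    rw [IsHermitian, conjTranspose_eq_transpose_of_trivial]
    simp only [transpose_sub, transpose_smul, transpose_add, transpose_mul, transpose_transpose, hT]
    rw [add_comm]
  · rw [star_trivial, dotProduct_sub_lyapunov A M hM.1]
    linarith [h A hA v]

/-- Every trajectory of a system solving the inequalities with rate `α` is `O(exp (α t))`. -/
theorem SolvesLMI.exists_norm_le {d : ℕ} {𝒜 : Set (Matrix (Fin d) (Fin d) ℝ)} {α : ℝ}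
    {M : Matrix (Fin d) (Fin d) ℝ} (h : SolvesLMI 𝒜 α M) {x : ℝ → Fin d → ℝ}
    (hx : IsTrajectory 𝒜 x) : ∃ C : ℝ, ∀ t, 0 ≤ t → ‖x t‖ ≤ C * Real.exp (α * t) := by
  obtain ⟨C, hC0, hC⟩ := h.1.exists_norm_sq_le
  refine ⟨Real.sqrt (C * (x 0 ⬝ᵥ M *ᵥ x 0)), fun t ht => ?_⟩
  have hq : 0 ≤ x 0 ⬝ᵥ M *ᵥ x 0 := by
    simpa using h.1.posSemidef.dotProduct_mulVec_nonneg (x 0)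
  refine le_of_sq_le_sq ?_ (by positivity)
  rw [mul_pow, Real.sq_sqrt (by positivity)]
  calc ‖x t‖ ^ 2 ≤ C * (x t ⬝ᵥ M *ᵥ x t) := hC _
    _ ≤ C * (Real.exp (2 * α * t) * (x 0 ⬝ᵥ M *ᵥ x 0)) := by
      gcongr
      exact hx.quadratic_le h.1.1 (fun A hA v => h.dotProduct_le hA v) ht
    _ = _ := by rw [← Real.exp_nat_mul]; push_cast; ring_nf

/-- A crude entrywise bound, needed so that the infimum defining the exponent is over a nonempty
set. -/
theorem exists_solvesLMI_one {d : ℕ} {𝒜 : Set (Matrix (Fin d) (Fin d) ℝ)} (hc : IsCompact 𝒜) :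
    ∃ s : ℝ, SolvesLMI 𝒜 s 1 := by
  obtain ⟨K, hK⟩ := hc.exists_entry_bound
  refine ⟨d * |K|, .of_dotProduct_le .one fun A hA v => ?_⟩
  rw [one_mulVec, one_mulVec]
  calc v ⬝ᵥ A *ᵥ v = ∑ i, ∑ j, v i * (A i j * v j) := by
        simp only [dotProduct, mulVec, Finset.mul_sum]
    _ ≤ ∑ i, ∑ j, |K| * ((v i ^ 2 + v j ^ 2) / 2) := by
        refine Finset.sum_le_sum fun i _ => Finset.sum_le_sum fun j _ => ?_
        have h1 : |A i j| ≤ |K| := (hK A hA i j).trans (le_abs_self K)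
        calc v i * (A i j * v j) ≤ |v i * (A i j * v j)| := le_abs_self _
          _ = |A i j| * (|v i| * |v j|) := by rw [abs_mul, abs_mul]; ring
          _ ≤ |K| * ((v i ^ 2 + v j ^ 2) / 2) := by
            gcongr
            nlinarith [sq_nonneg (|v i| - |v j|), sq_abs (v i), sq_abs (v j)]
    _ = d * |K| * (v ⬝ᵥ v) := by
        simp only [← Finset.mul_sum, ← Finset.sum_div, Finset.sum_add_distrib, Finset.sum_const,
          Finset.card_univ, Fintype.card_fin, nsmul_eq_mul, dotProduct, ← sq]
        ring

theorem exists_norm_le_of_lyapunovExponent_lt {d : ℕ} {𝒜 : Set (Matrix (Fin d) (Fin d) ℝ)}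
    (hc : IsCompact 𝒜) {s : ℝ} (hs : lyapunovExponent 𝒜 < s) (x : ℝ → Fin d → ℝ)
    (hx : IsTrajectory 𝒜 x) : ∃ C : ℝ, ∀ t, 0 ≤ t → ‖x t‖ ≤ C * Real.exp (s * t) := by
  obtain ⟨s₀, h₀⟩ := exists_solvesLMI_one hc
  have hne : {s : ℝ | ∀ x : ℝ → Fin d → ℝ, IsTrajectory 𝒜 x →
      ∃ C : ℝ, ∀ t, 0 ≤ t → ‖x t‖ ≤ C * Real.exp (s * t)}.Nonempty :=
    ⟨s₀, fun x hx => h₀.exists_norm_le hx⟩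
  obtain ⟨r, hr, hrs⟩ := exists_lt_of_csInf_lt hne hs
  obtain ⟨C, hC⟩ := hr x hx
  refine ⟨|C|, fun t ht => (hC t ht).trans ?_⟩
  gcongr
  exact le_abs_self C

/-- Two consecutive arcs of the convexified system cannot expand faster than the Lyapunov
exponent. -/
theorem sq_le_abs_det_sub_exp_mul_exp_lyapunovExponent {𝒜 : Set (Matrix (Fin 2) (Fin 2) ℝ)}
    (hc : IsCompact 𝒜) {A B : Matrix (Fin 2) (Fin 2) ℝ} (hA : A ∈ convexHull ℝ 𝒜)
    (hB : B ∈ convexHull ℝ 𝒜) {t r : ℝ} (ht : 0 ≤ t) (hr : 0 ≤ r) {l : ℝ} (hl : 1 ≤ l) :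
    (l - 1) ^ 2 ≤ |(l • (1 : Matrix (Fin 2) (Fin 2) ℝ) -
      NormedSpace.exp (t • (A - lyapunovExponent 𝒜 • (1 : Matrix (Fin 2) (Fin 2) ℝ))) *
        NormedSpace.exp
          (r • (B - lyapunovExponent 𝒜 • (1 : Matrix (Fin 2) (Fin 2) ℝ)))).det| := by
  rw [Matrix.exp_smul_sub_smul_one, Matrix.exp_smul_sub_smul_one]
  have hcont : Continuous fun s : ℝ => |(l • (1 : Matrix (Fin 2) (Fin 2) ℝ) -
      (Real.exp (-(s * t)) • NormedSpace.exp (t • A)) *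
        (Real.exp (-(s * r)) • NormedSpace.exp (r • B))).det| := by
    fun_prop
  refine ge_of_tendsto ((hcont.tendsto (lyapunovExponent 𝒜)).mono_left
    -- The infimum is not known to be attained, so the inequality is taken for rates `s > σ` and
    -- passed to the limit.
    (nhdsWithin_le_nhds (s := Set.Ioi (lyapunovExponent 𝒜)))) ?_
  filter_upwards [self_mem_nhdsWithin] with s hs
  exact sq_le_abs_det_sub_exp_mul_exp hc
    (fun x hx => exists_norm_le_of_lyapunovExponent_lt hc hs x hx) hA hB ht hr hl

/-! ### Quadratic norms as Barabanov norms, and uniqueness -/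

theorem Matrix.PosDef.isNormOn_quadraticNorm {d : ℕ} {M : Matrix (Fin d) (Fin d) ℝ}
    (hM : M.PosDef) : IsNormOn (quadraticNorm M) := by
  have hnn : ∀ v : Fin d → ℝ, 0 ≤ v ⬝ᵥ M *ᵥ v := fun v => by
    simpa using hM.posSemidef.dotProduct_mulVec_nonneg v
  have hpos : ∀ v : Fin d → ℝ, v ≠ 0 → 0 < v ⬝ᵥ M *ᵥ v := fun v hv => by
    simpa using hM.dotProduct_mulVec_pos hv
  refine ⟨fun x y => ?_, fun c x => ?_, fun x hx => ?_⟩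
  · have hcs : (x ⬝ᵥ M *ᵥ y) ^ 2 ≤ (x ⬝ᵥ M *ᵥ x) * (y ⬝ᵥ M *ᵥ y) := by
      rcases eq_or_ne y 0 with rfl | hy
      · simp
      -- Cauchy–Schwarz: the form is nonnegative at this combination, whose value is `yᵀMy` times
      -- the desired difference.
      have h := hnn ((y ⬝ᵥ M *ᵥ y) • x - (x ⬝ᵥ M *ᵥ y) • y)
      simp only [mulVec_sub, dotProduct_sub, sub_dotProduct, mulVec_smul, dotProduct_smul,
        smul_dotProduct, smul_eq_mul, hM.1.dotProduct_mulVec_comm y x] at h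
      refine le_of_mul_le_mul_left ?_ (hpos y hy)
      linarith
    have hle : x ⬝ᵥ M *ᵥ y ≤ Real.sqrt (x ⬝ᵥ M *ᵥ x) * Real.sqrt (y ⬝ᵥ M *ᵥ y) := by
      rw [← Real.sqrt_mul (hnn x)]
      exact Real.le_sqrt_of_sq_le hcs
    refine Real.sqrt_le_iff.2 ⟨by unfold quadraticNorm; positivity, ?_⟩
    simp only [mulVec_add, dotProduct_add, add_dotProduct, hM.1.dotProduct_mulVec_comm y x]
    rw [quadraticNorm, quadraticNorm, add_sq, Real.sq_sqrt (hnn x), Real.sq_sqrt (hnn y)]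
    linarith
  · rw [quadraticNorm, mulVec_smul, dotProduct_smul, smul_dotProduct, smul_eq_mul, smul_eq_mul,
      ← mul_assoc, ← sq, Real.sqrt_mul (sq_nonneg c), Real.sqrt_sq_eq_abs, quadraticNorm]
  · by_contra h
    exact (Real.sqrt_pos.2 (hpos x h)).ne' hx

theorem IsNormOn.nonneg {d : ℕ} {f : (Fin d → ℝ) → ℝ} (hf : IsNormOn f) (x : Fin d → ℝ) :
    0 ≤ f x := by
  have h0 : f 0 = 0 := by simpa using hf.smul_eq 0 0
  have hn : f (-x) = f x := by simpa using hf.smul_eq (-1) x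
  have := hf.add_le x (-x)
  rw [add_neg_cancel, h0, hn] at this
  linarith

theorem quadraticNorm_sq {d : ℕ} {M : Matrix (Fin d) (Fin d) ℝ} (hM : M.PosDef)
    (x : Fin d → ℝ) : quadraticNorm M x ^ 2 = x ⬝ᵥ M *ᵥ x :=
  Real.sq_sqrt (by simpa using hM.posSemidef.dotProduct_mulVec_nonneg x)

/-- A norm that is constant on the level sets of a quadratic norm is proportional to it. -/
theorem IsNormOn.exists_eq_mul_quadraticNorm {f : (Fin 2 → ℝ) → ℝ} (hf : IsNormOn f)
    {M : Matrix (Fin 2) (Fin 2) ℝ} (hM : M.PosDef)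
    (h : ∀ x y, x ⬝ᵥ M *ᵥ x = y ⬝ᵥ M *ᵥ y → f y ≤ f x) :
    ∃ c : ℝ, 0 < c ∧ ∀ x, f x = c * quadraticNorm M x := by
  have hQ := hM.isNormOn_quadraticNorm
  set e : Fin 2 → ℝ := fun _ => 1
  have he : e ≠ 0 := fun h => one_ne_zero (congrFun h 0)
  have hQe : 0 < quadraticNorm M e := (hQ.nonneg e).lt_of_ne' fun h => he (hQ.eq_zero e h)
  have hfe : 0 < f e := (hf.nonneg e).lt_of_ne' fun h => he (hf.eq_zero e h)
  refine ⟨f e / quadraticNorm M e, by positivity, fun x => ?_⟩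
  set k := quadraticNorm M x / quadraticNorm M e
  have hk : 0 ≤ k := div_nonneg (hQ.nonneg x) hQe.le
  have hq : x ⬝ᵥ M *ᵥ x = (k • e) ⬝ᵥ M *ᵥ (k • e) := by
    rw [← quadraticNorm_sq hM, ← quadraticNorm_sq hM, hQ.smul_eq, abs_of_nonneg hk,
      div_mul_cancel₀ _ hQe.ne']
  have : f x = f (k • e) := le_antisymm (h _ _ hq.symm) (h _ _ hq)
  rw [this, hf.smul_eq, abs_of_nonneg hk]
  rw [div_mul_eq_mul_div, mul_div_assoc, mul_comm]

theorem SolvesLMI.dotProduct_rotation_eq_zero {𝒜 : Set (Matrix (Fin 2) (Fin 2) ℝ)} {α b : ℝ}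
    {A J M : Matrix (Fin 2) (Fin 2) ℝ} (h : SolvesLMI 𝒜 α M) (hA : A ∈ 𝒜) (hb : 0 < b)
    (hJ : J * J = -1) (hAJ : A - α • (1 : Matrix (Fin 2) (Fin 2) ℝ) = b • J) (v : Fin 2 → ℝ) :
    v ⬝ᵥ M *ᵥ (J *ᵥ v) = 0 := by
  refine Matrix.dotProduct_mulVec_eq_zero_of_nonpos hJ h.1.1 (fun v => ?_) v
  have h1 := h.dotProduct_le hA v
  have h2 : A = α • (1 : Matrix (Fin 2) (Fin 2) ℝ) + b • J := by rw [← hAJ]; abel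
  rw [h2, add_mulVec, smul_mulVec, smul_mulVec, one_mulVec, mulVec_add, mulVec_smul, mulVec_smul,
    dotProduct_add, dotProduct_smul, dotProduct_smul, smul_eq_mul, smul_eq_mul] at h1
  nlinarith

theorem SolvesLMI.lyapunovExponent_eq {𝒜 : Set (Matrix (Fin 2) (Fin 2) ℝ)} {α b : ℝ}
    {A J M : Matrix (Fin 2) (Fin 2) ℝ} (h : SolvesLMI 𝒜 α M) (hA : A ∈ 𝒜) (hb : 0 < b)
    (hJ : J * J = -1) (hAJ : A - α • (1 : Matrix (Fin 2) (Fin 2) ℝ) = b • J) :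
    lyapunovExponent 𝒜 = α := by
  have hlower : ∀ s : ℝ, (∀ x : ℝ → Fin 2 → ℝ, IsTrajectory 𝒜 x →
      ∃ C : ℝ, ∀ t, 0 ≤ t → ‖x t‖ ≤ C * Real.exp (s * t)) → α ≤ s := by
    intro s hs
    obtain ⟨C, hC⟩ := hs _ (isTrajectory_exp hA 1)
    -- After each period `T` the rotation is the identity, so the trajectory of `A` from the
    -- all-ones vector has norm exactly `exp (α k T)` at time `k T`; no rate `s < α` can bound it.
    set T := 2 * Real.pi / b with hT
    have hTpos : 0 < T := by positivity
    by_contra! hlt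
    obtain ⟨k, hk⟩ := exists_nat_gt (C / ((α - s) * T))
    have h1 := hC (k * T) (by positivity)
    have h2 : k * T * b = k * (2 * Real.pi) := by rw [hT]; field_simp
    rw [exp_smul_eq_exp_smul_rotation hAJ, Matrix.exp_smul_of_mul_self_eq_neg_one hJ, h2,
      Real.cos_nat_mul_two_pi, Real.sin_periodic.nat_mul_eq k, Real.sin_zero, one_smul, zero_smul, add_zero, smul_mulVec,
      one_mulVec, norm_smul, norm_one, mul_one, Real.norm_of_nonneg (Real.exp_pos _).le] at h1
    have h3 : Real.exp ((α - s) * (k * T)) ≤ C := by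
      rw [sub_mul, Real.exp_sub]
      exact (div_le_iff₀ (Real.exp_pos _)).2 h1
    have h4 := Real.add_one_le_exp ((α - s) * (k * T))
    rw [div_lt_iff₀ (mul_pos (sub_pos.2 hlt) hTpos)] at hk
    linarith
  exact le_antisymm (csInf_le ⟨α, hlower⟩ fun x hx => h.exists_norm_le hx)
    (le_csInf ⟨α, fun x hx => h.exists_norm_le hx⟩ hlower)

theorem SolvesLMI.isBarabanovNorm {𝒜 : Set (Matrix (Fin 2) (Fin 2) ℝ)} {α b : ℝ}
    {A J M : Matrix (Fin 2) (Fin 2) ℝ} (h : SolvesLMI 𝒜 α M) (hA : A ∈ 𝒜) (hb : 0 < b)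
    (hJ : J * J = -1) (hAJ : A - α • (1 : Matrix (Fin 2) (Fin 2) ℝ) = b • J) :
    IsBarabanovNorm 𝒜 (quadraticNorm M) := by
  have hσ := h.lyapunovExponent_eq hA hb hJ hAJ
  have hQ := h.1.isNormOn_quadraticNorm
  refine ⟨hQ, fun x hx t ht => ?_, fun x₀ => ?_⟩
  · refine le_of_sq_le_sq ?_ (mul_nonneg (Real.exp_pos _).le (hQ.nonneg _))
    rw [mul_pow, quadraticNorm_sq h.1, quadraticNorm_sq h.1, hσ, ← Real.exp_nat_mul]
    refine (hx.quadratic_le h.1.1 (fun A hA v => h.dotProduct_le hA v) ht).trans (le_of_eq ?_)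
    push_cast
    ring_nf
  · refine ⟨_, (isTrajectory_exp hA x₀).mono (subset_convexHull ℝ 𝒜), by simp, fun t _ => ?_⟩
    rw [hσ, exp_smul_eq_exp_smul_rotation hAJ, smul_mulVec, hQ.smul_eq,
      abs_of_pos (Real.exp_pos _), quadraticNorm, quadraticNorm,
      Matrix.quadraticForm_exp_mulVec hJ h.1.1 (h.dotProduct_rotation_eq_zero hA hb hJ hAJ)]

theorem SolvesLMI.barabanovNorm_unique {𝒜 : Set (Matrix (Fin 2) (Fin 2) ℝ)} {α b : ℝ}
    {A J M : Matrix (Fin 2) (Fin 2) ℝ} (h : SolvesLMI 𝒜 α M) (hA : A ∈ 𝒜) (hb : 0 < b)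
    (hJ : J * J = -1) (hAJ : A - α • (1 : Matrix (Fin 2) (Fin 2) ℝ) = b • J)
    {f : (Fin 2 → ℝ) → ℝ} (hf : IsBarabanovNorm 𝒜 f) :
    ∃ c : ℝ, 0 < c ∧ ∀ x, f x = c * quadraticNorm M x := by
  have hσ := h.lyapunovExponent_eq hA hb hJ hAJ
  refine hf.isNorm.exists_eq_mul_quadraticNorm h.1 fun x y hxy => ?_
  obtain ⟨θ, hθ, rfl⟩ := Matrix.exists_exp_mulVec_eq hJ h.1
    (h.dotProduct_rotation_eq_zero hA hb hJ hAJ) hxy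
  -- At time `θ / b` the flow of `A` is `exp (α θ / b)` times the rotation by `θ`; the scalar
  -- cancels against the allowed growth.
  have h1 := hf.le_exp _ (isTrajectory_exp hA x) (θ / b) (by positivity)
  rw [hσ, exp_smul_eq_exp_smul_rotation hAJ, smul_mulVec, hf.isNorm.smul_eq,
    abs_of_pos (Real.exp_pos _), div_mul_cancel₀ _ hb.ne', zero_smul, NormedSpace.exp_zero,
    one_mulVec] at h1
  exact le_of_mul_le_mul_left h1 (Real.exp_pos _)

/-! ### From a dominant matrix in the hull to one in `𝒜` -/

/-- A matrix with positive form derivative at `v` moves `v` outside of its ellipse. -/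
theorem Matrix.exists_exp_quadraticForm_gt {n : Type*} [Fintype n] [DecidableEq n]
    {B M : Matrix n n ℝ} (hM : M.IsHermitian) {v : n → ℝ} (h : 0 < v ⬝ᵥ M *ᵥ (B *ᵥ v)) :
    ∃ r : ℝ, 0 < r ∧ v ⬝ᵥ M *ᵥ v <
      (NormedSpace.exp (r • B) *ᵥ v) ⬝ᵥ M *ᵥ (NormedSpace.exp (r • B) *ᵥ v) := by
  have hd := (B.hasDerivAt_exp_mulVec v 0 0).quadraticForm hM
  simp only [sub_zero, zero_smul, NormedSpace.exp_zero, one_mulVec] at hd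
  have hs := (hasDerivAt_iff_tendsto_slope.1 hd).eventually (lt_mem_nhds (a := 0) (by linarith))
  have hs' := hs.filter_mono (nhdsWithin_mono 0 fun t (ht : t ∈ Set.Ioi (0 : ℝ)) => ht.ne')
  obtain ⟨r, hr, hr0⟩ := (hs'.and self_mem_nhdsWithin).exists
  refine ⟨r, hr0, ?_⟩
  have := (slope_pos_iff_of_le (le_of_lt hr0)).1 hr
  simpa using this

/-- If the convexified system contains `σ + b J`, `J² = -1`, then the invariant quadratic form of
`J` solves the Lyapunov inequalities. -/
theorem solvesLMI_of_rotation {𝒜 : Set (Matrix (Fin 2) (Fin 2) ℝ)} (hc : IsCompact 𝒜)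
    {b : ℝ} {A J M : Matrix (Fin 2) (Fin 2) ℝ} (hA : A ∈ convexHull ℝ 𝒜) (hb : 0 < b)
    (hJ : J * J = -1)
    (hAJ : A - lyapunovExponent 𝒜 • (1 : Matrix (Fin 2) (Fin 2) ℝ) = b • J)
    (hM : M.PosDef) (hMJ : ∀ v, v ⬝ᵥ M *ᵥ (J *ᵥ v) = 0) :
    SolvesLMI 𝒜 (lyapunovExponent 𝒜) M := by
  set σ := lyapunovExponent 𝒜
  refine .of_dotProduct_le hM fun B hB v => ?_
  by_contra! hlt
  have hv : v ≠ 0 := by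
    rintro rfl
    simp at hlt
  have hqv : 0 < v ⬝ᵥ M *ᵥ v := by simpa using hM.dotProduct_mulVec_pos hv
  have hB' : 0 < v ⬝ᵥ M *ᵥ ((B - σ • (1 : Matrix (Fin 2) (Fin 2) ℝ)) *ᵥ v) := by
    rw [sub_mulVec, smul_mulVec, one_mulVec, mulVec_sub, dotProduct_sub, mulVec_smul,
      dotProduct_smul, smul_eq_mul]
    linarith
  obtain ⟨r, hr, hry⟩ := Matrix.exists_exp_quadraticForm_gt hM.1 hB'
  set Q := NormedSpace.exp (r • (B - σ • (1 : Matrix (Fin 2) (Fin 2) ℝ)))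
  -- The factor by which `B` expands the ellipse of `v`: `Q v` and `l v` lie on the same level set,
  -- so a rotation joins them.
  set l := Real.sqrt (((Q *ᵥ v) ⬝ᵥ M *ᵥ (Q *ᵥ v)) / (v ⬝ᵥ M *ᵥ v)) with hl
  have hl1 : 1 < l := by
    rw [hl, Real.lt_sqrt zero_le_one, one_pow, one_lt_div hqv]
    exact hry
  have hql : (Q *ᵥ v) ⬝ᵥ M *ᵥ (Q *ᵥ v) = (l • v) ⬝ᵥ M *ᵥ (l • v) := by
    rw [mulVec_smul, dotProduct_smul, smul_dotProduct, smul_eq_mul, smul_eq_mul, ← mul_assoc, ← sq,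
      hl, Real.sq_sqrt (div_nonneg (hqv.trans hry).le hqv.le), div_mul_cancel₀ _ hqv.ne']
  obtain ⟨θ, hθ, hrot⟩ := Matrix.exists_exp_mulVec_eq hJ hM hMJ hql
  have hkey := sq_le_abs_det_sub_exp_mul_exp_lyapunovExponent hc hA
    (subset_convexHull ℝ 𝒜 hB) (t := θ / b) (r := r) (by positivity) hr.le hl1.le
  have hdet : (l • (1 : Matrix (Fin 2) (Fin 2) ℝ) -
      NormedSpace.exp ((θ / b) • (A - σ • (1 : Matrix (Fin 2) (Fin 2) ℝ))) * Q).det = 0 := by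
    refine Matrix.exists_mulVec_eq_zero_iff.1 ⟨v, hv, ?_⟩
    rw [hAJ, smul_smul, div_mul_cancel₀ _ hb.ne', sub_mulVec, smul_mulVec, one_mulVec,
      ← mulVec_mulVec, hrot, sub_self]
  rw [hdet, abs_zero] at hkey
  nlinarith [sq_pos_of_pos (sub_pos.2 hl1)]

/-- If `M B` is a nonzero antisymmetric form, then `B` has imaginary nonzero eigenvalues. -/
theorem Matrix.trace_det_of_skew {M B : Matrix (Fin 2) (Fin 2) ℝ} (hM : M.PosDef) (hB : B ≠ 0)
    (h : ∀ v, v ⬝ᵥ M *ᵥ (B *ᵥ v) = 0) : B.trace = 0 ∧ 0 < B.det := by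
  set S := M * B with hS
  have hq : ∀ v, v ⬝ᵥ S *ᵥ v = 0 := fun v => by rw [hS, ← mulVec_mulVec, h]
  -- These three vectors already force `S` to be skew, hence determined by `S 0 1`. Then `B = M⁻¹ S`
  -- has trace 0, being symmetric times skew, and `det B` has the sign of `det S = (S 0 1)²`.
  have h0 := hq ![1, 0]
  have h1 := hq ![0, 1]
  have h2 := hq ![1, 1]
  simp [mulVec, dotProduct, Fin.sum_univ_two] at h0 h1 h2
  have hMdet := hM.det_pos
  have hunit : IsUnit M.det := hMdet.ne'.isUnit
  have hBS : B = M⁻¹ * S := by rw [hS, Matrix.nonsing_inv_mul_cancel_left _ _ hunit]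
  have hM01 : M 0 1 = M 1 0 := by simpa using hM.1.apply 1 0
  have h10 : S 1 0 = -S 0 1 := by linarith
  have hdetS : S.det = S 0 1 ^ 2 := by rw [det_fin_two, h0, h1, h10]; ring
  have hS01 : S 0 1 ≠ 0 := by
    intro h01
    have : S = 0 := by
      ext i j
      fin_cases i <;> fin_cases j <;> simp [h0, h1, h10, h01]
    rw [this, mul_zero] at hBS
    exact hB hBS
  constructor
  · rw [hBS, Matrix.inv_def, smul_mul_assoc, trace_smul, adjugate_fin_two, trace_fin_two]
    simp [mul_apply, Fin.sum_univ_two, h0, h1, h10, hM01]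
  · have : M.det * B.det = S 0 1 ^ 2 := by rw [← hdetS, hS, det_mul]
    have h3 : 0 < M.det * B.det := by rw [this]; positivity
    exact (pos_iff_pos_of_mul_pos h3).1 hMdet

/-- If some matrix of the convex hull, different from `σ`, preserves the form up to the factor
`σ`, then so does some matrix of `𝒜`. -/
theorem SolvesLMI.exists_skew_mem {d : ℕ} {𝒜 : Set (Matrix (Fin d) (Fin d) ℝ)} {σ : ℝ}
    {A M : Matrix (Fin d) (Fin d) ℝ} (h : SolvesLMI 𝒜 σ M) (hA : A ∈ convexHull ℝ 𝒜)
    (hne : A ≠ σ • (1 : Matrix (Fin d) (Fin d) ℝ))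
    (hskew : ∀ v, v ⬝ᵥ M *ᵥ (A *ᵥ v) = σ * (v ⬝ᵥ M *ᵥ v)) :
    ∃ B ∈ 𝒜, B ≠ σ • (1 : Matrix (Fin d) (Fin d) ℝ) ∧
      ∀ v, v ⬝ᵥ M *ᵥ (B *ᵥ v) = σ * (v ⬝ᵥ M *ᵥ v) := by
  by_contra! hcon
  -- Strictness at one vector persists in a convex combination with positive weights, so `D` is
  -- convex; adjoining `σ I` lets it contain all of `𝒜` if no suitable `B` exists, and `A` then
  -- violates `D`.
  set D : Set (Matrix (Fin d) (Fin d) ℝ) :=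
    {B | (∀ v, v ⬝ᵥ M *ᵥ (B *ᵥ v) ≤ σ * (v ⬝ᵥ M *ᵥ v)) ∧
      ((∃ v, v ⬝ᵥ M *ᵥ (B *ᵥ v) < σ * (v ⬝ᵥ M *ᵥ v)) ∨
        B = σ • (1 : Matrix (Fin d) (Fin d) ℝ))} with hD
  have hsub : 𝒜 ⊆ D := by
    intro B hB
    refine ⟨fun v => h.dotProduct_le hB v, ?_⟩
    by_cases hBσ : B = σ • (1 : Matrix (Fin d) (Fin d) ℝ)
    · exact Or.inr hBσ
    · obtain ⟨v, hv⟩ := hcon B hB hBσ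
      exact Or.inl ⟨v, (h.dotProduct_le hB v).lt_of_ne hv⟩
  have hconv : Convex ℝ D := by
    rw [convex_iff_forall_pos]
    intro X hX Y hY a b ha hb hab
    have hval : ∀ v, v ⬝ᵥ M *ᵥ ((a • X + b • Y) *ᵥ v) =
        a * (v ⬝ᵥ M *ᵥ (X *ᵥ v)) + b * (v ⬝ᵥ M *ᵥ (Y *ᵥ v)) := fun v => by
      simp only [add_mulVec, smul_mulVec, mulVec_add, mulVec_smul, dotProduct_add, dotProduct_smul,
        smul_eq_mul]
    have hsum : ∀ q : ℝ, σ * q = a * (σ * q) + b * (σ * q) := fun q => by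
      rw [← add_mul, hab, one_mul]
    refine ⟨fun v => ?_, ?_⟩
    · rw [hval, hsum]
      exact add_le_add (mul_le_mul_of_nonneg_left (hX.1 v) ha.le)
        (mul_le_mul_of_nonneg_left (hY.1 v) hb.le)
    · rcases hX.2 with ⟨v, hv⟩ | hX'
      · refine Or.inl ⟨v, ?_⟩
        rw [hval, hsum]
        exact add_lt_add_of_lt_of_le (mul_lt_mul_of_pos_left hv ha)
          (mul_le_mul_of_nonneg_left (hY.1 v) hb.le)
      · rcases hY.2 with ⟨v, hv⟩ | hY'
        · refine Or.inl ⟨v, ?_⟩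
          rw [hval, hsum]
          exact add_lt_add_of_le_of_lt (mul_le_mul_of_nonneg_left (hX.1 v) ha.le)
            (mul_lt_mul_of_pos_left hv hb)
        · exact Or.inr (by rw [hX', hY', ← add_smul, hab, one_smul])
  obtain ⟨-, ⟨v, hv⟩ | hA'⟩ := convexHull_min hsub hconv hA
  · exact hv.ne (hskew v)
  · exact hne hA'

theorem HasComplexDominance.exists_solvesLMI {𝒜 : Set (Matrix (Fin 2) (Fin 2) ℝ)}
    (hc : IsCompact 𝒜) (h : HasComplexDominance 𝒜) :
    ∃ A₀ ∈ 𝒜, ∃ α β : ℝ, β ≠ 0 ∧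
      complexSpectrum A₀ = {(α : ℂ) + β * Complex.I, (α : ℂ) - β * Complex.I} ∧
      ∃ M : Matrix (Fin 2) (Fin 2) ℝ, SolvesLMI 𝒜 α M := by
  obtain ⟨A, ⟨hA, hne, ⟨z, hz, hre⟩, -⟩, him⟩ := h
  obtain ⟨b, hb, J, hJ, hAJ⟩ := exists_eq_add_smul_of_mem_complexSpectrum hz (him z hz)
  rw [hre] at hAJ
  set σ := lyapunovExponent 𝒜
  obtain ⟨M, hM, hMJ⟩ : ∃ M : Matrix (Fin 2) (Fin 2) ℝ, M.PosDef ∧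
      ∀ v, v ⬝ᵥ M *ᵥ (J *ᵥ v) = 0 := by
    -- Up to scale, the identity form averaged over `1` and `J`; it is `J`-invariant because `J² =
    -- -1`.
    refine ⟨Jᵀ * J + 1, ?_, fun v => ?_⟩
    · rw [← conjTranspose_eq_transpose_of_trivial]
      exact PosDef.posSemidef_add (posSemidef_conjTranspose_mul_self J) .one
    · rw [add_mulVec, one_mulVec, ← mulVec_mulVec, mulVec_mulVec _ J J, hJ, neg_mulVec, one_mulVec,
        mulVec_neg, dotProduct_add, dotProduct_neg, dotProduct_mulVec v Jᵀ, vecMul_transpose,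
        dotProduct_comm, neg_add_cancel]
  have hLMI := solvesLMI_of_rotation hc hA hb hJ hAJ hM hMJ
  have hA' : A = σ • (1 : Matrix (Fin 2) (Fin 2) ℝ) + b • J := by rw [← hAJ]; abel
  obtain ⟨B, hB, hBne, hBskew⟩ := hLMI.exists_skew_mem hA hne fun v => by
    rw [hA', add_mulVec, smul_mulVec, smul_mulVec, one_mulVec, mulVec_add, mulVec_smul,
      mulVec_smul, dotProduct_add, dotProduct_smul, dotProduct_smul, hMJ, smul_zero, add_zero,
      smul_eq_mul]
  obtain ⟨htr, hdet⟩ := Matrix.trace_det_of_skew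
    (B := B - σ • (1 : Matrix (Fin 2) (Fin 2) ℝ)) hM (sub_ne_zero.2 hBne) fun v => by
      rw [sub_mulVec, smul_mulVec, one_mulVec, mulVec_sub, dotProduct_sub, mulVec_smul,
        dotProduct_smul, smul_eq_mul, hBskew, sub_self]
  have htrB : B.trace = 2 * σ := by
    rw [trace_fin_two] at htr ⊢
    simp at htr
    linarith
  set δ := (B - σ • (1 : Matrix (Fin 2) (Fin 2) ℝ)).det with hδ
  refine ⟨B, hB, σ, Real.sqrt δ, (Real.sqrt_pos.2 hdet).ne', complexSpectrum_eq_pair htrB ?_,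
    _, hLMI⟩
  rw [Real.sq_sqrt hdet.le, hδ, det_fin_two, det_fin_two]
  rw [trace_fin_two] at htrB
  simp
  linear_combination σ * htrB

theorem isDominant_of_eq_lyapunovExponent {𝒜 : Set (Matrix (Fin 2) (Fin 2) ℝ)}
    {A : Matrix (Fin 2) (Fin 2) ℝ} (hA : A ∈ 𝒜) {α β : ℝ} (hβ : β ≠ 0)
    (hspec : complexSpectrum A = {(α : ℂ) + β * Complex.I, (α : ℂ) - β * Complex.I})
    (hσ : lyapunovExponent 𝒜 = α) : IsDominant 𝒜 A := by
  refine ⟨subset_convexHull ℝ 𝒜 hA, ?_, ?_⟩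
  · intro h
    have hz : (α : ℂ) + β * Complex.I ∈ complexSpectrum A := by simp [hspec]
    obtain ⟨htr, hdet⟩ := trace_det_of_mem_complexSpectrum hz (by simpa using hβ)
    rw [h, hσ, det_fin_two] at hdet
    simp at hdet
    exact hβ (pow_eq_zero_iff two_ne_zero |>.1 (by linarith))
  · rw [hspec, hσ]
    simp [Set.image_pair]

theorem mainTheorem8 (𝒜 : Set (Matrix (Fin 2) (Fin 2) ℝ))
    (hcompact : IsCompact 𝒜) (hirr : IsIrreducibleFamily 𝒜) :
    (HasComplexDominance 𝒜 ↔
      ∃ A₀ ∈ 𝒜, ∃ α β : ℝ, β ≠ 0 ∧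
        complexSpectrum A₀ = {(α : ℂ) + β * Complex.I, (α : ℂ) - β * Complex.I} ∧
        ∃ M : Matrix (Fin 2) (Fin 2) ℝ, SolvesLMI 𝒜 α M) ∧
    (∀ A₀ ∈ 𝒜, ∀ α β : ℝ, β ≠ 0 →
      complexSpectrum A₀ = {(α : ℂ) + β * Complex.I, (α : ℂ) - β * Complex.I} →
      ∀ M : Matrix (Fin 2) (Fin 2) ℝ, SolvesLMI 𝒜 α M →
        lyapunovExponent 𝒜 = α ∧
        IsDominant 𝒜 A₀ ∧
        IsBarabanovNorm 𝒜 (quadraticNorm M) ∧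
        ∀ f : (Fin 2 → ℝ) → ℝ, IsBarabanovNorm 𝒜 f →
          ∃ c : ℝ, 0 < c ∧ ∀ x, f x = c * quadraticNorm M x) := by
  have main : ∀ A₀ ∈ 𝒜, ∀ α β : ℝ, β ≠ 0 →
      complexSpectrum A₀ = {(α : ℂ) + β * Complex.I, (α : ℂ) - β * Complex.I} →
      ∀ M : Matrix (Fin 2) (Fin 2) ℝ, SolvesLMI 𝒜 α M →
        lyapunovExponent 𝒜 = α ∧
        IsDominant 𝒜 A₀ ∧
        IsBarabanovNorm 𝒜 (quadraticNorm M) ∧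
        ∀ f : (Fin 2 → ℝ) → ℝ, IsBarabanovNorm 𝒜 f →
          ∃ c : ℝ, 0 < c ∧ ∀ x, f x = c * quadraticNorm M x := by
    intro A₀ hA₀ α β hβ hspec M hM
    have hz : (α : ℂ) + β * Complex.I ∈ complexSpectrum A₀ := by simp [hspec]
    obtain ⟨b, hb, J, hJ, hAJ⟩ :=
      exists_eq_add_smul_of_mem_complexSpectrum hz (by simpa using hβ)
    have hre : ((α : ℂ) + β * Complex.I).re = α := by simp
    rw [hre] at hAJ
    have hσ := hM.lyapunovExponent_eq hA₀ hb hJ hAJ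
    exact ⟨hσ, isDominant_of_eq_lyapunovExponent hA₀ hβ hspec hσ,
      hM.isBarabanovNorm hA₀ hb hJ hAJ, fun f hf => hM.barabanovNorm_unique hA₀ hb hJ hAJ hf⟩
  refine ⟨⟨fun h => h.exists_solvesLMI hcompact, ?_⟩, main⟩
  rintro ⟨A₀, hA₀, α, β, hβ, hspec, M, hM⟩
  refine ⟨A₀, (main A₀ hA₀ α β hβ hspec M hM).2.1, fun z hz => ?_⟩
  rw [hspec] at hz
  rcases hz with rfl | rfl <;> simpa using hβ
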